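/- Let $n\ge 6$ and $k>n$, and let $k$ qubits $q_1,\dots,q_k$ be arranged on a line. Consider circuits built from the single-qubit gates $R_x(\theta)=e^{-i\theta X/2}$ and $R_z(\theta)=e^{-i\theta Z/2}$ ($\theta\in\mathbb R$), $H$, $T=\mathrm{diag}(1,e^{i\pi/4})$ and $T^\dagger$, and CNOT gates in either direction on neighboring qubits $q_l,q_{l+1}$ (linear-nearest-neighbor connectivity). A circuit is a sequence of time slots, each holding gates that act on pairwise disjoint sets of qubits. For a type of gate, its cost is the number of gates of this type in the circuit, and its depth is the number of time slots that hold at least one gate of this type; $T$ and $T^\dagger$ are both counted as T gates. Then for every choice of a set $C$ of $n$ control qubits among $q_1,\dots,q_k$, every target qubit $t\in\{q_1,\dots,q_k\}\setminus C$ and every $W\in SU(2)$, there is such a circuit on these $k$ qubits (without further ancilla qubits) that implements exactly the multi-controlled gate that applies $W$ to $t$ if all qubits of $C$ are in state $|1\rangle$ and acts as the identity otherwise, that uses $8$ gates of the form $R_x(\theta)$ or $R_z(\theta)$, and whose other gates satisfy simultaneously - CNOT cost at most $10k+12n-50$ and CNOT depth at most $9k+4n-5$; - T cost at most $16n-32$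 and T depth at most $4n$; - H cost at most $8n-10$ and H depth at most $4n-3$. -/

import Mathlib

namespace LNN

/-- Operators on `k` qubits, as matrices in the computational basis, whose elements are the
bit strings `Fin k → Fin 2`.  The row is the output string, the column the input string. -/
abbrev Op (k : ℕ) : Type := Matrix (Fin k → Fin 2) (Fin k → Fin 2) ℂ

/-- The multi-controlled gate: `U` acts on qubit `t` if all qubits in `C` are in state `1`, and
nothing happens otherwise.  All qubits other than `t` keep their basis state. -/
noncomputable def controlled {k : ℕ} (C : Finset (Fin k)) (t : Fin k)
    (U : Matrix (Fin 2) (Fin 2) ℂ) : Op k :=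
  open Classical in
  Matrix.of fun x y =>
    if ∀ i, i ≠ t → x i = y i then
      if ∀ i ∈ C, y i = 1 then U (x t) (y t) else (1 : Matrix (Fin 2) (Fin 2) ℂ) (x t) (y t)
    else 0

/-- A single-qubit operator applied to qubit `q`, identity on all others. -/
noncomputable def single {k : ℕ} (q : Fin k) (U : Matrix (Fin 2) (Fin 2) ℂ) : Op k :=
  controlled ∅ q U

/-- `R_x(θ) = exp(-i θ X / 2)`. -/
noncomputable def matRx (θ : ℝ) : Matrix (Fin 2) (Fin 2) ℂ :=
  !![(Real.cos (θ / 2) : ℂ), -Complex.I * (Real.sin (θ / 2) : ℂ);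
     -Complex.I * (Real.sin (θ / 2) : ℂ), (Real.cos (θ / 2) : ℂ)]

/-- `R_z(θ) = exp(-i θ Z / 2)`. -/
noncomputable def matRz (θ : ℝ) : Matrix (Fin 2) (Fin 2) ℂ :=
  !![Complex.exp (-Complex.I * (θ / 2 : ℝ)), 0; 0, Complex.exp (Complex.I * (θ / 2 : ℝ))]

/-- The Pauli matrix `X`. -/
def matX : Matrix (Fin 2) (Fin 2) ℂ := !![0, 1; 1, 0]

/-- The Hadamard matrix. -/
noncomputable def matH : Matrix (Fin 2) (Fin 2) ℂ :=
  ((Real.sqrt 2 : ℂ)⁻¹) • !![1, 1; 1, -1]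

/-- `T = diag(1, exp(i π / 4))`. -/
noncomputable def matT : Matrix (Fin 2) (Fin 2) ℂ :=
  !![1, 0; 0, Complex.exp (Complex.I * (Real.pi / 4 : ℝ))]

/-- The elementary gates on `k` qubits. -/
inductive Gate (k : ℕ) : Type
  | rx (θ : ℝ) (q : Fin k)
  | rz (θ : ℝ) (q : Fin k)
  | cnot (control target : Fin k) (ne : control ≠ target)
  | t (q : Fin k)
  | tdg (q : Fin k)
  | h (q : Fin k)

namespace Gate

variable {k : ℕ}

/-- The operator that a gate applies to the `k` qubits. -/
noncomputable def toOp : Gate k → Op k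
  | rx θ q => single q (matRx θ)
  | rz θ q => single q (matRz θ)
  | cnot c d _ => controlled {c} d matX
  | t q => single q matT
  | tdg q => single q matT.conjTranspose
  | h q => single q matH

/-- The qubits on which a gate acts. -/
def qubits : Gate k → Finset (Fin k)
  | rx _ q => {q}
  | rz _ q => {q}
  | cnot c d _ => {c, d}
  | t q => {q}
  | tdg q => {q}
  | h q => {q}

/-- Linear-nearest-neighbor connectivity: a CNOT acts on two consecutive qubits of the line, in
either direction; there is no restriction on single-qubit gates. -/
def IsLNN : Gate k → Prop
  | cnot c d _ => (c : ℕ) + 1 = d ∨ (d : ℕ) + 1 = c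
  | _ => True

/-- Rotations `R_x(θ)` and `R_z(θ)`. -/
def isRotation : Gate k → Bool
  | rx _ _ => true
  | rz _ _ => true
  | _ => false

/-- CNOT gates. -/
def isCNOT : Gate k → Bool
  | cnot _ _ _ => true
  | _ => false

/-- T gates; `T` and its inverse are both counted. -/
def isT : Gate k → Bool
  | t _ => true
  | tdg _ => true
  | _ => false

/-- Hadamard gates. -/
def isH : Gate k → Bool
  | h _ => true
  | _ => false

end Gate

/-- A circuit on `k` qubits: a sequence of time slots in order of execution, each holding gates
that act on pairwise disjoint sets of qubits. -/
structure Circuit (k : ℕ) : Type where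
  slots : List (List (Gate k))
  disjoint : ∀ L ∈ slots, L.Pairwise fun g g' => Disjoint g.qubits g'.qubits

namespace Circuit

variable {k : ℕ}

/-- The operator implemented by a circuit; the gate executed first is the rightmost factor. -/
noncomputable def toOp (c : Circuit k) : Op k :=
  (c.slots.flatten.map Gate.toOp).reverse.prod

/-- All gates of the circuit respect linear-nearest-neighbor connectivity. -/
def IsLNN (c : Circuit k) : Prop :=
  ∀ L ∈ c.slots, ∀ g ∈ L, g.IsLNN

/-- The number of gates of the kind `p`. -/
def cost (p : Gate k → Bool) (c : Circuit k) : ℕ :=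
  c.slots.flatten.countP p

/-- The depth of the gates of the kind `p`: the number of time slots that hold such a gate. -/
def depth (p : Gate k → Bool) (c : Circuit k) : ℕ :=
  c.slots.countP fun L => L.any p

end Circuit

end LNN

/-!
Every `W ∈ SU(2)` is a conjugate `V R_x(φ) V⁻¹` with `V = R_x(γ) R_z(β)`
(`LNN.exists_eq_conj_matRx`), so it suffices to implement a multi-controlled `R_x(φ)` with four
rotations.

*Commutator.* Divide the controls into two classes, and let `M₁`, `M₂` be diagonal sign operators
such that flipping the target changes the sign of `Mᵢ` exactly when all controls of the `i`-th class
are `1`. Then `M₁, R_x(α), M₂, R_x(-α), M₁, R_x(α), M₂, R_x(-α)` is the rotation `R_x(-4α)` if all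
controls are `1` and the identity otherwise (`LNN.commutator_eq_controlled`). Each `Mᵢ` occurs
twice, so its dependence on everything but the target cancels. Therefore any qubit, in whatever
state, can serve as working space: the controls of the other class and idle qubits are used, and
unwanted summands in a computed bit do no harm as long as they do not involve the target.

*Sign operators.* `Mᵢ` is a CNOT gate conjugated by Hadamard gates on its target, that is a
controlled sign, conjugated by a chain of gadgets. A gadget at three consecutive qubits is, up to
phases, a Toffoli gate (`LNN.mono_gadget`) and uses four T gates. A chain carries a bit along the
line by CNOT gates and multiplies it by the controls of the class on its way
(`LNN.Line.mono_chain`, `LNN.Line.mono_chain_succ`, `LNN.Line.IsClass.exists_diag`). Controls are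
assigned to the classes alternately, so that the working qubit next to a control belongs to the
other class (`LNN.Line.exists_classes`). The first halves of all gadgets of a chain act on disjoint
qubits and are executed in parallel (`LNN.Line.ev_hads_wave`).

*Savings.* Consecutive sign operators share a time slot of Hadamard gates, and the Hadamard gates
on the last control are needed only at the very beginning and the very end, since nothing else acts
on that qubit (`LNN.Line.ev_wordSlots`). The qubits are numbered from the end of the line next to
the target, and the target is moved to index `1`, unless it is at index `0` already. Index `0` may
hold a control; the chain of its class then starts there. A move is a
sequence of pairs of CNOT gates that shifts the bits on the way and adds them to the target;
the sum is irrelevant because `R_x` commutes with the Pauli matrix `X`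
(`LNN.Line.exists_move_conj`).
-/

namespace LNN

open Matrix Function

/-! ### Operators on basis states -/

/-- The computational basis vector `|x⟩`. -/
def ket {k : ℕ} (x : Fin k → Fin 2) : (Fin k → Fin 2) → ℂ := Pi.single x 1

theorem op_ext {k : ℕ} {A B : Op k} (h : ∀ x, A *ᵥ ket x = B *ᵥ ket x) : A = B :=
  Matrix.ext_of_mulVec_single h

theorem ket_apply {k : ℕ} (x y : Fin k → Fin 2) : ket x y = if y = x then 1 else 0 := by
  simp [ket, Pi.single_apply]

theorem mulVec_ket_apply {k : ℕ} (A : Op k) (x y : Fin k → Fin 2) : (A *ᵥ ket y) x = A x y := by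
  simp [ket]

/-- The matrix that a multi-controlled `U` applies to its target when the state is `y`. -/
noncomputable def ctlMat {k : ℕ} (C : Finset (Fin k)) (U : Matrix (Fin 2) (Fin 2) ℂ)
    (y : Fin k → Fin 2) : Matrix (Fin 2) (Fin 2) ℂ :=
  open Classical in if ∀ i ∈ C, y i = 1 then U else 1

theorem ctlMat_update {k : ℕ} {C : Finset (Fin k)} (U : Matrix (Fin 2) (Fin 2) ℂ)
    (y : Fin k → Fin 2) {q : Fin k} (hq : q ∉ C) (b : Fin 2) :
    ctlMat C U (update y q b) = ctlMat C U y := by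
  have : (∀ i ∈ C, update y q b i = 1) ↔ ∀ i ∈ C, y i = 1 := by
    refine forall₂_congr fun i hi => ?_
    rw [update_of_ne (ne_of_mem_of_not_mem hi hq)]
  simp only [ctlMat, this]

theorem controlled_ket {k : ℕ} (C : Finset (Fin k)) (t : Fin k) (U : Matrix (Fin 2) (Fin 2) ℂ)
    (y : Fin k → Fin 2) :
    controlled C t U *ᵥ ket y = ∑ b, ctlMat C U y b (y t) • ket (update y t b) := by
  ext x
  rw [mulVec_ket_apply]
  simp only [Finset.sum_apply, Pi.smul_apply, ket_apply, smul_eq_mul, mul_ite, mul_one, mul_zero,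
    controlled, Matrix.of_apply]
  by_cases h : ∀ i, i ≠ t → x i = y i
  · have hx : ∀ b, x = update y t b ↔ b = x t := by
      intro b
      constructor
      · intro e; rw [e]; simp
      · rintro rfl
        ext i
        by_cases hi : i = t
        · subst hi; simp
        · rw [update_of_ne hi, h i hi]
    simp only [hx, Finset.sum_ite_eq', Finset.mem_univ, if_true, if_pos h, ctlMat]
    split_ifs <;> rfl
  · rw [if_neg h, Finset.sum_eq_zero]
    intro b _
    rw [if_neg]
    rintro rfl
    exact h fun i hi => update_of_ne hi _ _

theorem controlled_mul {k : ℕ} {C : Finset (Fin k)} {t : Fin k} (ht : t ∉ C)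
    (U V : Matrix (Fin 2) (Fin 2) ℂ) :
    controlled C t U * controlled C t V = controlled C t (U * V) := by
  apply op_ext
  intro y
  rw [← mulVec_mulVec, controlled_ket, controlled_ket, mulVec_sum]
  simp only [mulVec_smul, controlled_ket, ctlMat_update _ _ ht, update_idem, update_self,
    Finset.smul_sum, smul_smul]
  rw [Finset.sum_comm]
  refine Finset.sum_congr rfl fun b _ => ?_
  rw [← Finset.sum_smul]
  congr 1
  have : ctlMat C (U * V) y = ctlMat C U y * ctlMat C V y := by
    simp only [ctlMat]; split_ifs <;> simp
  rw [this, Matrix.mul_apply]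
  exact Finset.sum_congr rfl fun _ _ => mul_comm _ _

theorem controlled_one {k : ℕ} (C : Finset (Fin k)) (t : Fin k) : controlled C t 1 = 1 := by
  apply op_ext
  intro y
  have : ctlMat C 1 y = 1 := by simp [ctlMat]
  simp [controlled_ket, this, Matrix.one_apply, ite_smul]

theorem controlled_comm {k : ℕ} {C C' : Finset (Fin k)} {t t' : Fin k}
    (U U' : Matrix (Fin 2) (Fin 2) ℂ) (h : t ∉ insert t' C') (h' : t' ∉ insert t C) :
    controlled C t U * controlled C' t' U' = controlled C' t' U' * controlled C t U := by
  simp only [Finset.mem_insert, not_or] at h h'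
  apply op_ext
  intro y
  simp only [← mulVec_mulVec, controlled_ket, mulVec_sum, mulVec_smul, ctlMat_update _ _ h.2,
    ctlMat_update _ _ h'.2, Finset.smul_sum, smul_smul, update_of_ne h.1, update_of_ne h'.1]
  rw [Finset.sum_comm]
  refine Finset.sum_congr rfl fun b _ => Finset.sum_congr rfl fun b' _ => ?_
  rw [update_comm h.1, mul_comm]

/-! ### Gates as controlled operators, and lists of gates -/

namespace Gate

variable {k : ℕ}

/-- The control qubits of a gate. -/
def ctl : Gate k → Finset (Fin k)
  | cnot c _ _ => {c}
  | _ => ∅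

/-- The qubit that a gate changes. -/
def tgt : Gate k → Fin k
  | rx _ q => q
  | rz _ q => q
  | cnot _ d _ => d
  | t q => q
  | tdg q => q
  | h q => q

/-- The matrix that a gate applies to its target. -/
noncomputable def mat : Gate k → Matrix (Fin 2) (Fin 2) ℂ
  | rx θ _ => matRx θ
  | rz θ _ => matRz θ
  | cnot _ _ _ => matX
  | t _ => matT
  | tdg _ => matT.conjTranspose
  | h _ => matH

theorem toOp_eq (g : Gate k) : g.toOp = controlled g.ctl g.tgt g.mat := by
  cases g <;> rfl

theorem qubits_eq (g : Gate k) : g.qubits = insert g.tgt g.ctl := by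
  cases g <;> simp [qubits, tgt, ctl, Finset.pair_comm]

theorem tgt_notMem_ctl (g : Gate k) : g.tgt ∉ g.ctl := by
  cases g with
  | cnot c d ne => simpa [tgt, ctl] using ne.symm
  | _ => simp [ctl]

theorem tgt_mem_qubits (g : Gate k) : g.tgt ∈ g.qubits := by
  rw [qubits_eq]; exact Finset.mem_insert_self _ _

/-- The inverse gate. -/
noncomputable def inv : Gate k → Gate k
  | rx θ q => rx (-θ) q
  | rz θ q => rz (-θ) q
  | cnot c d ne => cnot c d ne
  | t q => tdg q
  | tdg q => t q
  | h q => h q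

@[simp] theorem inv_inv (g : Gate k) : g.inv.inv = g := by cases g <;> simp [inv]
@[simp] theorem qubits_inv (g : Gate k) : g.inv.qubits = g.qubits := by cases g <;> rfl
@[simp] theorem isRotation_inv (g : Gate k) : g.inv.isRotation = g.isRotation := by cases g <;> rfl
@[simp] theorem isCNOT_inv (g : Gate k) : g.inv.isCNOT = g.isCNOT := by cases g <;> rfl
@[simp] theorem isT_inv (g : Gate k) : g.inv.isT = g.isT := by cases g <;> rfl
@[simp] theorem isH_inv (g : Gate k) : g.inv.isH = g.isH := by cases g <;> rfl
@[simp] theorem isLNN_inv (g : Gate k) : g.inv.IsLNN ↔ g.IsLNN := by cases g <;> rfl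

end Gate

theorem matRx_mul (a b : ℝ) : matRx a * matRx b = matRx (a + b) := by
  have h1 : ((a + b) / 2 : ℝ) = a / 2 + b / 2 := by ring
  have hI := Complex.I_mul_I
  simp only [matRx, h1, Real.cos_add, Real.sin_add]
  ext i j
  fin_cases i <;> fin_cases j <;> simp [Matrix.mul_apply, Fin.sum_univ_two] <;>
    first
    | ring1
    | linear_combination (Complex.sin (a / 2) * Complex.sin (b / 2)) * hI

theorem matRx_zero : matRx 0 = 1 := by
  ext i j
  fin_cases i <;> fin_cases j <;> simp [matRx]

theorem matRz_mul (a b : ℝ) : matRz a * matRz b = matRz (a + b) := by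
  ext i j
  fin_cases i <;> fin_cases j <;> simp [matRz, Matrix.mul_apply, Fin.sum_univ_two] <;>
    rw [← Complex.exp_add] <;> congr 1 <;> ring

theorem matRz_zero : matRz 0 = 1 := by
  ext i j
  fin_cases i <;> fin_cases j <;> simp [matRz]

theorem matX_mul_self : matX * matX = 1 := by
  ext i j
  fin_cases i <;> fin_cases j <;> simp [matX]

theorem sqrt_two_inv_mul_self : ((Real.sqrt 2 : ℂ)⁻¹) * ((Real.sqrt 2 : ℂ)⁻¹) = 1 / 2 := by
  rw [← mul_inv, ← Complex.ofReal_mul, Real.mul_self_sqrt (by norm_num)]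
  norm_num

theorem matH_mul_self : matH * matH = 1 := by
  have h := sqrt_two_inv_mul_self
  ext i j
  fin_cases i <;> fin_cases j <;>
    simp [matH, Matrix.mul_apply, Fin.sum_univ_two] <;> simp [← sq] at h ⊢ <;> rw [h] <;> norm_num

/-- The phase of the `T` gate. -/
noncomputable def om : ℂ := Complex.exp (Complex.I * (Real.pi / 4 : ℝ))

theorem conj_om_mul_om : (starRingEnd ℂ) om * om = 1 := by
  rw [om, ← Complex.exp_conj, ← Complex.exp_add, map_mul, Complex.conj_I, Complex.conj_ofReal]
  simp

theorem om_pow_four : om ^ 4 = -1 := by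
  rw [om, ← Complex.exp_nat_mul, ← Complex.exp_pi_mul_I]
  congr 1
  push_cast
  ring

theorem matT_eq : matT = !![1, 0; 0, om] := rfl

theorem matT_conj_eq : matT.conjTranspose = !![1, 0; 0, (starRingEnd ℂ) om] := by
  ext i j
  fin_cases i <;> fin_cases j <;> simp [matT_eq]

theorem matT_mul_conj : matT * matT.conjTranspose = 1 := by
  have h := conj_om_mul_om
  rw [mul_comm] at h
  rw [matT_conj_eq, matT_eq]
  ext i j
  fin_cases i <;> fin_cases j <;> simp [h]

theorem matT_conj_mul : matT.conjTranspose * matT = 1 := by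
  have h := conj_om_mul_om
  rw [matT_conj_eq, matT_eq]
  ext i j
  fin_cases i <;> fin_cases j <;> simp [h]

namespace Gate
theorem mat_inv_mul {k : ℕ} (g : Gate k) : g.inv.mat * g.mat = 1 := by
  cases g <;> simp [inv, mat, matRx_mul, matRz_mul, matRx_zero, matRz_zero, matX_mul_self,
    matH_mul_self, matT_mul_conj, matT_conj_mul]

theorem inv_toOp_mul {k : ℕ} (g : Gate k) : g.inv.toOp * g.toOp = 1 := by
  have h1 : g.inv.ctl = g.ctl := by cases g <;> rfl
  have h2 : g.inv.tgt = g.tgt := by cases g <;> rfl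
  rw [toOp_eq, toOp_eq, h1, h2, controlled_mul g.tgt_notMem_ctl, mat_inv_mul, controlled_one]

/-- Two gates none of which changes a qubit of the other. -/
def Indep {k : ℕ} (g g' : Gate k) : Prop := g.tgt ∉ g'.qubits ∧ g'.tgt ∉ g.qubits

theorem Indep.of_disjoint {k : ℕ} {g g' : Gate k} (h : Disjoint g.qubits g'.qubits) :
    g.Indep g' :=
  ⟨fun hm => Finset.disjoint_left.1 h g.tgt_mem_qubits hm,
    fun hm => Finset.disjoint_left.1 h hm g'.tgt_mem_qubits⟩

theorem Indep.comm {k : ℕ} {g g' : Gate k} (h : g.Indep g') :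
    g.toOp * g'.toOp = g'.toOp * g.toOp := by
  rw [toOp_eq, toOp_eq]
  apply controlled_comm
  · rw [← qubits_eq]; exact h.1
  · rw [← qubits_eq]; exact h.2
end Gate

/-- The operator of a list of gates in order of execution. -/
noncomputable def ev {k : ℕ} (l : List (Gate k)) : Op k := (l.map Gate.toOp).reverse.prod

section ev
variable {k : ℕ}

@[simp] theorem ev_nil : ev ([] : List (Gate k)) = 1 := rfl

theorem ev_append (l l' : List (Gate k)) : ev (l ++ l') = ev l' * ev l := by
  simp [ev]

theorem ev_cons (g : Gate k) (l : List (Gate k)) : ev (g :: l) = ev l * g.toOp := by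
  simp [ev]

theorem ev_singleton (g : Gate k) : ev [g] = g.toOp := by simp [ev]

/-- The inverse list of gates. -/
noncomputable def invL (l : List (Gate k)) : List (Gate k) := (l.map Gate.inv).reverse

theorem invL_append (l l' : List (Gate k)) : invL (l ++ l') = invL l' ++ invL l := by
  simp [invL]

theorem invL_invL (l : List (Gate k)) : invL (invL l) = l := by
  simp [invL, Function.comp_def]

theorem ev_invL_mul (l : List (Gate k)) : ev (invL l) * ev l = 1 := by
  induction l with
  | nil => simp [invL]
  | cons g l ih =>
    have : invL (g :: l) = invL l ++ [g.inv] := by simp [invL]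
    rw [this, ev_append, ev_singleton, ev_cons]
    calc g.inv.toOp * ev (invL l) * (ev l * g.toOp)
        = g.inv.toOp * (ev (invL l) * ev l) * g.toOp := by simp only [mul_assoc]
      _ = 1 := by rw [ih, mul_one, Gate.inv_toOp_mul]

theorem ev_mul_invL (l : List (Gate k)) : ev l * ev (invL l) = 1 := by
  have := ev_invL_mul (invL l)
  rwa [invL_invL] at this

theorem ev_invL_congr {l l' : List (Gate k)} (h : ev l = ev l') : ev (invL l) = ev (invL l') := by
  calc ev (invL l) = ev (invL l) * (ev l' * ev (invL l')) := by rw [ev_mul_invL, mul_one]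
    _ = ev (invL l') := by rw [← h, ← mul_assoc, ev_invL_mul, one_mul]

/-- Lists of mutually independent gates commute. -/
theorem ev_swap {A B : List (Gate k)} (h : ∀ g ∈ A, ∀ g' ∈ B, g.Indep g') :
    ev (A ++ B) = ev (B ++ A) := by
  have key : ∀ (g : Gate k) (B : List (Gate k)), (∀ g' ∈ B, g.Indep g') →
      ev B * g.toOp = g.toOp * ev B := by
    intro g B hB
    induction B with
    | nil => simp
    | cons b B ih =>
      rw [ev_cons, mul_assoc, ← (hB b (by simp)).comm, ← mul_assoc,
        ih fun g' hg => hB g' (by simp [hg]), mul_assoc]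
  induction A with
  | nil => simp
  | cons a A ih =>
    have ih := ih fun g hg => h g (by simp [hg])
    rw [ev_append, ev_append] at ih
    rw [ev_append, ev_append, ev_cons, ← mul_assoc, ih, mul_assoc,
      key a B fun g' hg => h a (by simp) g' hg, mul_assoc]

end ev

/-! ### The gadget that multiplies two bits into a third one -/

section gadget
variable {k : ℕ}

theorem ev_cons_mulVec (g : Gate k) (l : List (Gate k)) (v : (Fin k → Fin 2) → ℂ) :
    ev (g :: l) *ᵥ v = ev l *ᵥ (g.toOp *ᵥ v) := by
  rw [ev_cons, mulVec_mulVec]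

theorem cnot_ket (c d : Fin k) (ne : c ≠ d) (x : Fin k → Fin 2) :
    (Gate.cnot c d ne).toOp *ᵥ ket x = ket (update x d (x d + x c)) := by
  rw [Gate.toOp, controlled_ket, Fin.sum_univ_two]
  simp only [ctlMat, Finset.mem_singleton, forall_eq]
  generalize x c = a
  generalize x d = b
  obtain rfl | rfl : b = 0 ∨ b = 1 := by revert b; decide
  all_goals obtain rfl | rfl : a = 0 ∨ a = 1 := by revert a; decide
  all_goals simp [matX]

/-- The diagonal entry of `diag(1, z)` on the bit `b`. -/
def ph (z : ℂ) (b : Fin 2) : ℂ := if b = 1 then z else 1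

theorem t_ket (q : Fin k) (x : Fin k → Fin 2) :
    (Gate.t q).toOp *ᵥ ket x = ph om (x q) • ket x := by
  rw [Gate.toOp, single, controlled_ket, Fin.sum_univ_two]
  have hd : x q = 0 ∨ x q = 1 := by generalize x q = b; fin_cases b <;> simp
  rcases hd with hd | hd <;> rw [hd, ← update_eq_self q x, hd] <;> simp [ctlMat, matT_eq, ph]

theorem tdg_ket (q : Fin k) (x : Fin k → Fin 2) :
    (Gate.tdg q).toOp *ᵥ ket x = ph ((starRingEnd ℂ) om) (x q) • ket x := by
  rw [Gate.toOp, single, controlled_ket, Fin.sum_univ_two]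
  have hd : x q = 0 ∨ x q = 1 := by generalize x q = b; fin_cases b <;> simp
  rcases hd with hd | hd <;> rw [hd, ← update_eq_self q x, hd, matT_conj_eq] <;>
    simp [ctlMat, ph]

theorem h_ket (q : Fin k) (x : Fin k → Fin 2) :
    (Gate.h q).toOp *ᵥ ket x = ((Real.sqrt 2 : ℂ)⁻¹) •
      (ket (update x q 0) + ph (-1) (x q) • ket (update x q 1)) := by
  rw [Gate.toOp, single, controlled_ket, Fin.sum_univ_two]
  have hd : x q = 0 ∨ x q = 1 := by generalize x q = b; fin_cases b <;> simp
  rcases hd with hd | hd <;> simp [hd, ctlMat, matH, ph]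

/-- `A` permutes the basis states by `π`, up to phases. -/
def Mono (A : Op k) (π : (Fin k → Fin 2) → Fin k → Fin 2) : Prop :=
  ∀ x, ∃ c : ℂ, A *ᵥ ket x = c • ket (π x)

theorem Mono.one : Mono (1 : Op k) id := fun x => ⟨1, by simp⟩

theorem Mono.mul {A B : Op k} {π ρ : (Fin k → Fin 2) → Fin k → Fin 2} (hA : Mono A π)
    (hB : Mono B ρ) : Mono (B * A) (ρ ∘ π) := by
  intro x
  obtain ⟨c, hc⟩ := hA x
  obtain ⟨d, hd⟩ := hB (π x)
  exact ⟨c * d, by rw [← mulVec_mulVec, hc, mulVec_smul, hd, smul_smul]; rfl⟩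

theorem Mono.cnot (c d : Fin k) (ne : c ≠ d) :
    Mono (Gate.cnot c d ne).toOp fun x => update x d (x d + x c) :=
  fun x => ⟨1, by rw [cnot_ket, one_smul]⟩

/-- The part of the gadget that does not involve the qubit `l`. -/
def gadgetPre (m r : Fin k) (hmr : m ≠ r) : List (Gate k) :=
  [.h r, .cnot r m hmr.symm, .t r, .tdg m, .cnot m r hmr]

/-- The rest of the gadget. -/
def gadgetPost (l m r : Fin k) (hlm : l ≠ m) (hmr : m ≠ r) : List (Gate k) :=
  [.cnot l m hlm, .cnot m r hmr, .t m, .tdg r, .cnot r m hmr.symm, .h r]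

/-- Up to phases, the gadget is a Toffoli gate. It is a Hadamard conjugate of a gate that adds
`x l` to `x r` with a phase; this phase is `± i`, depending on `x r`, if `x l = x m = 1`, and
trivial otherwise. -/
theorem mono_gadget (l m r : Fin k) (hlm : l ≠ m) (hmr : m ≠ r) (hlr : l ≠ r) :
    Mono (ev (gadgetPre m r hmr ++ gadgetPost l m r hlm hmr))
      fun x => update x r (x r + x l * x m) := by
  have inner : ∀ x : Fin k → Fin 2,
      ev [.cnot r m hmr.symm, .t r, .tdg m, .cnot m r hmr, .cnot l m hlm, .cnot m r hmr, .t m,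
        .tdg r, .cnot r m hmr.symm] *ᵥ ket x =
      (ph om (x r) * ph ((starRingEnd ℂ) om) (x m + x r) * ph om (x m + x r + x l) *
        ph ((starRingEnd ℂ) om) (x r + x l)) • ket (update x r (x r + x l)) := by
    intro x
    simp only [ev_cons_mulVec, ev_nil, one_mulVec, cnot_ket, t_ket, tdg_ket, mulVec_smul,
      smul_smul, update_self, update_of_ne hmr, update_of_ne hmr.symm, update_of_ne hlm,
      update_of_ne hlr]
    have e2 : ∀ a c z : Fin 2, z + (c + z) + (c + z + a) = z + a := by decide
    have e3 : ∀ a c z : Fin 2, c + z + a + (z + a) = c := by decide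
    simp only [e2, e3]
    congr 1
    · ring
    · congr 1
      ext i
      by_cases hi : i = m
      · subst hi; simp [hmr]
      · by_cases hr : i = r
        · subst hr; simp [hmr.symm]
        · simp [hi, hr]
  intro x
  have hlist : gadgetPre m r hmr ++ gadgetPost l m r hlm hmr =
      Gate.h r :: ([.cnot r m hmr.symm, .t r, .tdg m, .cnot m r hmr, .cnot l m hlm,
        .cnot m r hmr, .t m, .tdg r, .cnot r m hmr.symm] ++ [Gate.h r]) := rfl
  have h2 := conj_om_mul_om
  have h4 := om_pow_four
  have hI : om * om * ((starRingEnd ℂ) om * (starRingEnd ℂ) om) = 1 := by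
    linear_combination (om * (starRingEnd ℂ) om + 1) * h2
  have hneg : (starRingEnd ℂ) om * (starRingEnd ℂ) om = - (om * om) := by
    linear_combination ((starRingEnd ℂ) om * (starRingEnd ℂ) om) * h4 - (om * om) * hI
  have hp : ∀ a c z : Fin 2, ph om z * ph ((starRingEnd ℂ) om) (c + z) * ph om (c + z + a) *
      ph ((starRingEnd ℂ) om) (z + a) = ph (ph (-1) (z + 1) * (om * om)) (a * c) := by
    intro a c z
    fin_cases a <;> fin_cases c <;> fin_cases z <;> simp [ph] <;>
      first
      | linear_combination h2
      | linear_combination hneg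
      | linear_combination hI
  have hs := sqrt_two_inv_mul_self
  rw [hlist, ev_cons_mulVec, ev_append, ev_singleton, ← mulVec_mulVec, h_ket]
  simp only [mulVec_smul, mulVec_add, inner, update_self, update_of_ne hmr, update_of_ne hlr,
    update_idem, h_ket, hp]
  generalize x l = a
  generalize x m = c
  generalize x r = z
  refine ⟨ph (ph (-1) z) a * ph (om * om) (a * c), ?_⟩
  generalize om * om = w
  generalize (Real.sqrt 2 : ℂ)⁻¹ = s at hs
  ext y
  fin_cases a <;> fin_cases c <;> fin_cases z <;> simp [ph] <;>
    generalize ket (update x r 0) y = u <;> generalize ket (update x r 1) y = v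
  all_goals
    first
    | linear_combination (2 * u) * hs
    | linear_combination (2 * v) * hs
    | linear_combination (-2 * v) * hs
    | linear_combination (2 * w * v) * hs
    | linear_combination (-2 * w * u) * hs
end gadget

/-! ### Qubits on a line and chains of gadgets -/

/-- A numbering of the `k` qubits along the line, by the indices below `k`, from either end.
Values at indices that are not below `k` are irrelevant. The field `two` provides a CNOT gate that
serves as a default value. -/
structure Line (k : ℕ) where
  pos : ℕ → Fin k
  inj : ∀ i j, i < k → j < k → pos i = pos j → i = j
  adj : ∀ i, i + 1 < k → (pos i : ℕ) + 1 = pos (i + 1) ∨ (pos (i + 1) : ℕ) + 1 = pos i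
  two : pos 0 ≠ pos 1

namespace Line

variable {k : ℕ} (L : Line k)

/-- The CNOT gate with control at index `i` and target at index `j`. If these are not distinct
qubits, it is some other CNOT gate, so that gate counts hold without side conditions. -/
noncomputable def cx (i j : ℕ) : Gate k :=
  open Classical in
  if h : L.pos i ≠ L.pos j then .cnot (L.pos i) (L.pos j) h else .cnot (L.pos 0) (L.pos 1) L.two

theorem pos_ne {i j : ℕ} (hi : i < k) (hj : j < k) (h : i ≠ j) : L.pos i ≠ L.pos j :=
  fun e => h (L.inj i j hi hj e)

theorem cx_eq {i j : ℕ} (hi : i < k) (hj : j < k) (h : i ≠ j) :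
    L.cx i j = .cnot (L.pos i) (L.pos j) (L.pos_ne hi hj h) := by
  rw [cx, dif_pos (L.pos_ne hi hj h)]

theorem exists_cx (i j : ℕ) : ∃ c d, ∃ ne : c ≠ d, L.cx i j = .cnot c d ne := by
  unfold cx
  split_ifs with h
  · exact ⟨_, _, h, rfl⟩
  · exact ⟨_, _, L.two, rfl⟩

@[simp] theorem inv_cx (i j : ℕ) : (L.cx i j).inv = L.cx i j := by
  obtain ⟨c, d, ne, h⟩ := L.exists_cx i j; rw [h]; rfl
@[simp] theorem isRotation_cx (i j : ℕ) : (L.cx i j).isRotation = false := by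
  obtain ⟨c, d, ne, h⟩ := L.exists_cx i j; rw [h]; rfl
@[simp] theorem isCNOT_cx (i j : ℕ) : (L.cx i j).isCNOT = true := by
  obtain ⟨c, d, ne, h⟩ := L.exists_cx i j; rw [h]; rfl
@[simp] theorem isT_cx (i j : ℕ) : (L.cx i j).isT = false := by
  obtain ⟨c, d, ne, h⟩ := L.exists_cx i j; rw [h]; rfl
@[simp] theorem isH_cx (i j : ℕ) : (L.cx i j).isH = false := by
  obtain ⟨c, d, ne, h⟩ := L.exists_cx i j; rw [h]; rfl

theorem isLNN_cx {i j : ℕ} (hi : i < k) (hj : j < k) (h : i + 1 = j ∨ j + 1 = i) :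
    (L.cx i j).IsLNN := by
  rw [L.cx_eq hi hj (by omega)]
  rcases h with rfl | rfl
  · exact L.adj i hj
  · exact (L.adj j hi).symm

/-- The gate `g` acts on qubits whose indices lie in `P` only. -/
def On (P : ℕ → Prop) (g : Gate k) : Prop := ∀ v ∈ g.qubits, ∃ i, P i ∧ i < k ∧ v = L.pos i

variable {L}

theorem On.mono {P Q : ℕ → Prop} {g : Gate k} (h : L.On P g) (hPQ : ∀ i, P i → Q i) :
    L.On Q g := fun v hv => by
  obtain ⟨i, hi, h⟩ := h v hv
  exact ⟨i, hPQ i hi, h⟩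

theorem On.disjoint {P Q : ℕ → Prop} {g g' : Gate k} (h : L.On P g) (h' : L.On Q g')
    (hPQ : ∀ i, P i → ¬ Q i) : Disjoint g.qubits g'.qubits := by
  rw [Finset.disjoint_left]
  intro v hv hv'
  obtain ⟨i, hi, hik, e⟩ := h v hv
  obtain ⟨j, hj, hjk, e'⟩ := h' v hv'
  have := L.inj i j hik hjk (e.symm.trans e')
  subst this
  exact hPQ i hi hj

theorem On.indep {P Q : ℕ → Prop} {g g' : Gate k} (h : L.On P g) (h' : L.On Q g')
    (hPQ : ∀ i, P i → ¬ Q i) : g.Indep g' := Gate.Indep.of_disjoint (h.disjoint h' hPQ)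

theorem On.inv {P : ℕ → Prop} {g : Gate k} (h : L.On P g) : L.On P g.inv := by
  rwa [On, Gate.qubits_inv]

variable (L)

theorem on_cx {P : ℕ → Prop} {i j : ℕ} (hi : i < k) (hj : j < k) (h : i ≠ j) (hPi : P i)
    (hPj : P j) : L.On P (L.cx i j) := by
  intro v hv
  rw [L.cx_eq hi hj h] at hv
  simp only [Gate.qubits, Finset.mem_insert, Finset.mem_singleton] at hv
  rcases hv with rfl | rfl
  · exact ⟨i, hPi, hi, rfl⟩
  · exact ⟨j, hPj, hj, rfl⟩

theorem on_of_qubits {P : ℕ → Prop} {i : ℕ} (hi : i < k) (hP : P i) {g : Gate k}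
    (hg : g.qubits = {L.pos i}) : L.On P g := by
  intro v hv
  rw [hg, Finset.mem_singleton] at hv
  exact ⟨i, hP, hi, hv⟩

theorem mono_cx {i j : ℕ} (hi : i < k) (hj : j < k) (h : i ≠ j) :
    Mono (L.cx i j).toOp fun x => update x (L.pos j) (x (L.pos j) + x (L.pos i)) := by
  rw [L.cx_eq hi hj h]; exact Mono.cnot _ _ _

/-- The first half of the gadget at the indices `q` and `q + 1`. -/
noncomputable def pre (q : ℕ) : List (Gate k) :=
  [.h (L.pos (q + 1)), L.cx (q + 1) q, .t (L.pos (q + 1)), .tdg (L.pos q), L.cx q (q + 1)]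

/-- The second half of the gadget at the indices `q - 1`, `q` and `q + 1`. -/
noncomputable def post (q : ℕ) : List (Gate k) :=
  [L.cx (q - 1) q, L.cx q (q + 1), .t (L.pos q), .tdg (L.pos (q + 1)), L.cx (q + 1) q,
    .h (L.pos (q + 1))]

/-- CNOT gates that add up the bits from index `p` to index `e`, the sum being formed at `e`. -/
noncomputable def cross (p e : ℕ) : List (Gate k) :=
  (List.range' p (e - p)).map fun i => L.cx i (i + 1)

/-- A chain of gadgets at the indices in `qs`: the bit at index `p` is multiplied by the bits at
`qs`, one after the other, and the result moves on to index `l - 1`. -/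
noncomputable def chain (l : ℕ) : ℕ → List ℕ → List (Gate k)
  | p, [] => L.cross p (l - 1)
  | p, q :: qs => L.cross p (q - 1) ++ (L.pre q ++ L.post q) ++ chain l (q + 1) qs

/-- The indices `p`, `q₁`, …, `qᵥ`, `l` leave room for the gadgets of a chain: each `qⱼ + 1` lies
below the next index. -/
def Spaced (l : ℕ) : ℕ → List ℕ → Prop
  | p, [] => p + 1 ≤ l
  | p, q :: qs => p + 1 ≤ q ∧ Spaced l (q + 1) qs

theorem Spaced.lt {l : ℕ} : ∀ {p : ℕ} {qs : List ℕ}, Spaced l p qs → p < l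
  | _, [], h => h
  | _, _ :: _, h => by have := Spaced.lt h.2; have := h.1; omega

theorem Spaced.mem {l : ℕ} : ∀ {p : ℕ} {qs : List ℕ}, Spaced l p qs →
    ∀ q ∈ qs, p + 1 ≤ q ∧ q + 2 ≤ l
  | _, [], _, _, hq => by simp at hq
  | _, q' :: qs, h, q, hq => by
    have h1 := h.1
    have h2 := Spaced.lt h.2
    rcases List.mem_cons.1 hq with rfl | hq
    · omega
    · have := Spaced.mem h.2 q hq; omega

/-- The sum of the bits from `p` to `e` is formed at index `e`; only its dependence on the bit at
`p` matters. -/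
theorem mono_cross {p e : ℕ} (hpe : p ≤ e) (he : e < k) :
    ∃ π, Mono (ev (L.cross p e)) π ∧
      (∀ x i, i < k → e < i → π x (L.pos i) = x (L.pos i)) ∧
      ∀ (x y : Fin k → Fin 2) (b : Fin 2), (∀ i, i < k → p < i → y (L.pos i) = x (L.pos i)) →
        y (L.pos p) = x (L.pos p) + b → π y (L.pos e) = π x (L.pos e) + b := by
  induction e, hpe using Nat.le_induction with
  | base =>
    refine ⟨id, ?_, fun _ _ _ _ => rfl, fun x y b _ h => h⟩
    simpa [cross] using Mono.one
  | succ e hpe ih =>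
    obtain ⟨π, h1, h2, h3⟩ := ih (by omega)
    have hc : L.cross p (e + 1) = L.cross p e ++ [L.cx e (e + 1)] := by
      have : e + 1 - p = (e - p) + 1 := by omega
      rw [cross, cross, this, List.range'_concat, List.map_append]
      simp [show p + (e - p) = e by omega]
    have hM := h1.mul (L.mono_cx (i := e) (by omega) he (by omega))
    rw [← ev_singleton, ← ev_append, ← hc] at hM
    refine ⟨_, hM, ?_, ?_⟩
    · intro x i hi hei
      rw [Function.comp_apply, update_of_ne (L.pos_ne hi he (by omega)), h2 x i hi (by omega)]
    · intro x y b hxy hp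
      simp only [Function.comp_apply, update_self]
      rw [h3 x y b hxy hp, h2 x _ he (by omega), h2 y _ he (by omega), hxy _ he (by omega),
        add_assoc]

theorem mono_gadget_at {q : ℕ} (h1 : 1 ≤ q) (hq : q + 1 < k) :
    Mono (ev (L.pre q ++ L.post q)) fun x => update x (L.pos (q + 1))
      (x (L.pos (q + 1)) + x (L.pos (q - 1)) * x (L.pos q)) := by
  have := mono_gadget (L.pos (q - 1)) (L.pos q) (L.pos (q + 1))
    (L.pos_ne (by omega) (by omega) (by omega)) (L.pos_ne (by omega) (by omega) (by omega))
    (L.pos_ne (by omega) (by omega) (by omega))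
  rw [gadgetPre, gadgetPost] at this
  rwa [pre, post, L.cx_eq (by omega) (by omega) (by omega),
    L.cx_eq (by omega) (by omega) (by omega), L.cx_eq (by omega) (by omega) (by omega)]

/-- Flipping the first bit of a chain flips its output if and only if the bits at `qs` are all
`1`, even when bits of index below `p` are changed at the same time. -/
theorem mono_chain {l : ℕ} (hl : l < k) : ∀ (p : ℕ) (qs : List ℕ), Spaced l p qs →
    ∃ π, Mono (ev (L.chain l p qs)) π ∧
      (∀ x i, i < k → l ≤ i → π x (L.pos i) = x (L.pos i)) ∧
      ∀ (x y : Fin k → Fin 2) (b : Fin 2), (∀ i, i < k → p < i → y (L.pos i) = x (L.pos i)) →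
        y (L.pos p) = x (L.pos p) + b → π y (L.pos (l - 1)) = π x (L.pos (l - 1)) +
          if ∀ q ∈ qs, x (L.pos q) = 1 then b else 0
  | p, [], h => by
    have hp : p + 1 ≤ l := h
    obtain ⟨π, h1, h2, h3⟩ := L.mono_cross (p := p) (e := l - 1) (by omega) (by omega)
    refine ⟨π, h1, fun x i hi hl => h2 x i hi (by omega), fun x y b hxy hp => ?_⟩
    rw [h3 x y b hxy hp]
    simp
  | p, q :: qs, h => by
    have hp := h.1
    have hlt := h.2.lt
    have hm := h.2.mem
    obtain ⟨π, h1, h2, h3⟩ := L.mono_cross (p := p) (e := q - 1) (by omega) (by omega)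
    obtain ⟨ρ, r1, r2, r3⟩ := mono_chain hl (q + 1) qs h.2
    have g1 := L.mono_gadget_at (q := q) (by omega) (by omega)
    have hM := (h1.mul g1).mul r1
    rw [← ev_append, ← ev_append] at hM
    refine ⟨_, hM, ?_, ?_⟩
    · intro x i hi hli
      rw [Function.comp_apply, r2 _ i hi hli, Function.comp_apply,
        update_of_ne (L.pos_ne hi (by omega) (by omega)), h2 x i hi (by omega)]
    · intro x y b hxy hpb
      have e1 := h3 x y b hxy hpb
      simp only [Function.comp_apply]
      rw [r3 (update (π x) (L.pos (q + 1))
        (π x (L.pos (q + 1)) + π x (L.pos (q - 1)) * π x (L.pos q))) _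
        (if x (L.pos q) = 1 then b else 0)]
      · congr 1
        have hx : ∀ q' ∈ qs, update (π x) (L.pos (q + 1)) (π x (L.pos (q + 1)) +
            π x (L.pos (q - 1)) * π x (L.pos q)) (L.pos q') = x (L.pos q') := by
          intro q' hq'
          have := hm q' hq'
          rw [update_of_ne (L.pos_ne (by omega) (by omega) (by omega)),
            h2 x q' (by omega) (by omega)]
        have hiff : (∀ q' ∈ qs, update (π x) (L.pos (q + 1)) (π x (L.pos (q + 1)) +
            π x (L.pos (q - 1)) * π x (L.pos q)) (L.pos q') = 1) ↔
            ∀ q' ∈ qs, x (L.pos q') = 1 :=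
          forall₂_congr fun q' hq' => by rw [hx q' hq']
        rw [if_congr hiff rfl rfl]
        by_cases ha : x (L.pos q) = 1 <;> simp [ha]
      · intro i hi hqi
        rw [update_of_ne (L.pos_ne hi (by omega) (by omega)),
          update_of_ne (L.pos_ne hi (by omega) (by omega)), h2 x i hi (by omega),
          h2 y i hi (by omega), hxy i hi (by omega)]
      · rw [update_self, update_self, e1, h2 x (q + 1) (by omega) (by omega),
          h2 y (q + 1) (by omega) (by omega), h2 x q (by omega) (by omega),
          h2 y q (by omega) (by omega), hxy _ (by omega) (by omega),
          hxy _ (by omega) (by omega)]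
        generalize x (L.pos (q + 1)) = u
        generalize x (L.pos q) = v
        generalize π x (L.pos (q - 1)) = w
        clear e1 hpb
        revert u v w b
        decide
end Line

namespace Line

variable {k : ℕ} (L : Line k)

/-- If the chain begins right below its first gadget, flipping the bit of that gadget flips the
output if and only if the first bit of the chain and the other bits at `qs` are all `1`. -/
theorem mono_chain_succ {l : ℕ} (hl : l < k) (p : ℕ) (qs : List ℕ)
    (h : Spaced l p ((p + 1) :: qs)) :
    ∃ π, Mono (ev (L.chain l p ((p + 1) :: qs))) π ∧
      (∀ x i, i < k → l ≤ i → π x (L.pos i) = x (L.pos i)) ∧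
      ∀ (x y : Fin k → Fin 2) (b : Fin 2), (∀ i, i < k → i ≠ p + 1 → y (L.pos i) = x (L.pos i)) →
        y (L.pos (p + 1)) = x (L.pos (p + 1)) + b → π y (L.pos (l - 1)) = π x (L.pos (l - 1)) +
          if ∀ q ∈ p :: qs, x (L.pos q) = 1 then b else 0 := by
  have hlt := h.2.lt
  have hm := h.2.mem
  obtain ⟨ρ, r1, r2, r3⟩ := L.mono_chain hl (p + 1 + 1) qs h.2
  have g1 := L.mono_gadget_at (q := p + 1) (by omega) (by omega)
  have hM := g1.mul r1
  rw [← ev_append] at hM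
  have hc : L.chain l p ((p + 1) :: qs) =
      L.pre (p + 1) ++ L.post (p + 1) ++ L.chain l (p + 1 + 1) qs := by
    simp [chain, cross]
  refine ⟨_, hc ▸ hM, ?_, ?_⟩
  · intro x i hi hli
    rw [Function.comp_apply, r2 _ i hi hli, update_of_ne (L.pos_ne hi (by omega) (by omega))]
  · intro x y b hxy hpb
    simp only [Function.comp_apply]
    rw [r3 (update x (L.pos (p + 1 + 1)) (x (L.pos (p + 1 + 1)) +
      x (L.pos (p + 1 - 1)) * x (L.pos (p + 1)))) _ (if x (L.pos p) = 1 then b else 0)]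
    · congr 1
      have hx : ∀ q' ∈ qs, update x (L.pos (p + 1 + 1)) (x (L.pos (p + 1 + 1)) +
          x (L.pos (p + 1 - 1)) * x (L.pos (p + 1))) (L.pos q') = x (L.pos q') := by
        intro q' hq'
        have := hm q' hq'
        rw [update_of_ne (L.pos_ne (by omega) (by omega) (by omega))]
      have hiff : (∀ q' ∈ qs, update x (L.pos (p + 1 + 1)) (x (L.pos (p + 1 + 1)) +
          x (L.pos (p + 1 - 1)) * x (L.pos (p + 1))) (L.pos q') = 1) ↔
          ∀ q' ∈ qs, x (L.pos q') = 1 :=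
        forall₂_congr fun q' hq' => by rw [hx q' hq']
      rw [if_congr hiff rfl rfl]
      by_cases ha : x (L.pos p) = 1 <;> simp [ha]
    · intro i hi hqi
      rw [update_of_ne (L.pos_ne hi (by omega) (by omega)),
        update_of_ne (L.pos_ne hi (by omega) (by omega)), hxy i hi (by omega)]
    · rw [update_self, update_self, hpb, hxy _ (by omega) (by omega), Nat.add_sub_cancel,
        hxy p (by omega) (by omega)]
      generalize x (L.pos (p + 1 + 1)) = u
      generalize x (L.pos p) = v
      generalize x (L.pos (p + 1)) = w
      clear hpb
      revert u v w b
      decide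

/-! ### The time slots of a chain -/

/-- One time slot per gate. -/
def singles (l : List (Gate k)) : List (List (Gate k)) := l.map fun g => [g]

/-- The inverse of a sequence of time slots. -/
noncomputable def invS (S : List (List (Gate k))) : List (List (Gate k)) := (S.map invL).reverse

theorem flatten_singles (l : List (Gate k)) : (singles l).flatten = l := by
  induction l with
  | nil => rfl
  | cons a l ih => simp only [singles, List.map_cons, List.flatten_cons] at ih ⊢; rw [ih]; rfl

theorem flatten_invS (S : List (List (Gate k))) : (invS S).flatten = invL S.flatten := by
  induction S with
  | nil => rfl
  | cons a S ih =>
    have : invS (a :: S) = invS S ++ [invL a] := by simp [invS]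
    rw [this, List.flatten_append, ih, List.flatten_cons, List.flatten_cons, invL_append]
    simp

/-- The Hadamard gates that begin the gadgets of a chain; they fit into one time slot. -/
noncomputable def hads (qs : List ℕ) : List (Gate k) := qs.map fun q => .h (L.pos (q + 1))

/-- The other gates of the first halves of the gadgets of a chain, executed for all gadgets in
parallel. -/
noncomputable def wave (qs : List ℕ) : List (List (Gate k)) :=
  [qs.map fun q => L.cx (q + 1) q,
    qs.flatMap fun q => [.t (L.pos (q + 1)), .tdg (L.pos q)],
    qs.map fun q => L.cx q (q + 1)]

/-- The part of a chain that runs along the line. The gates in `E` are executed in the time slot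
of the last Hadamard gate of the first gadget. -/
noncomputable def serial (l : ℕ) : List (Gate k) → ℕ → List ℕ → List (List (Gate k))
  | _, p, [] => singles (L.cross p (l - 1))
  | E, p, q :: qs => singles (L.cross p (q - 1)) ++
      [[L.cx (q - 1) q], [L.cx q (q + 1)], [.t (L.pos q), .tdg (L.pos (q + 1))],
        [L.cx (q + 1) q], .h (L.pos (q + 1)) :: E] ++ serial l [] (q + 1) qs

/-- The time slots of a chain that follow its first Hadamard gates. -/
noncomputable def half (l : ℕ) (E : List (Gate k)) (p : ℕ) (qs : List ℕ) :
    List (List (Gate k)) :=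
  L.wave qs ++ L.serial l E p qs

/-- A chain, a CNOT gate from its output to the index `l`, and the inverse of the chain, without
the first and the last time slot of Hadamard gates. -/
noncomputable def core (l : ℕ) (E : List (Gate k)) (p : ℕ) (qs : List ℕ) :
    List (List (Gate k)) :=
  L.half l E p qs ++ [[L.cx (l - 1) l]] ++ invS (L.half l E p qs)

theorem on_cross {p e : ℕ} (he : e < k) : ∀ g ∈ L.cross p e, L.On (fun i => p ≤ i ∧ i ≤ e) g := by
  intro g hg
  simp only [cross, List.mem_map, List.mem_range'_1] at hg
  obtain ⟨i, hi, rfl⟩ := hg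
  exact L.on_cx (by omega) (by omega) (by omega) (by omega) (by omega)

theorem on_pre {q : ℕ} (hq : q + 1 < k) : ∀ g ∈ L.pre q, L.On (fun i => q ≤ i ∧ i ≤ q + 1) g := by
  intro g hg
  simp only [pre, List.mem_cons, List.not_mem_nil, or_false] at hg
  rcases hg with rfl | rfl | rfl | rfl | rfl
  · exact L.on_of_qubits hq (by omega) rfl
  · exact L.on_cx (by omega) (by omega) (by omega) (by omega) (by omega)
  · exact L.on_of_qubits hq (by omega) rfl
  · exact L.on_of_qubits (i := q) (by omega) (by omega) rfl
  · exact L.on_cx (by omega) (by omega) (by omega) (by omega) (by omega)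

theorem on_post {q : ℕ} (h1 : 1 ≤ q) (hq : q + 1 < k) :
    ∀ g ∈ L.post q, L.On (fun i => q - 1 ≤ i ∧ i ≤ q + 1) g := by
  intro g hg
  simp only [post, List.mem_cons, List.not_mem_nil, or_false] at hg
  rcases hg with rfl | rfl | rfl | rfl | rfl | rfl
  · exact L.on_cx (by omega) (by omega) (by omega) (by omega) (by omega)
  · exact L.on_cx (by omega) (by omega) (by omega) (by omega) (by omega)
  · exact L.on_of_qubits (i := q) (by omega) (by omega) rfl
  · exact L.on_of_qubits hq (by omega) rfl
  · exact L.on_cx (by omega) (by omega) (by omega) (by omega) (by omega)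
  · exact L.on_of_qubits hq (by omega) rfl

theorem serial_cons_flatten (l : ℕ) (E : List (Gate k)) (p q : ℕ) (qs : List ℕ) :
    (L.serial l E p (q :: qs)).flatten =
      L.cross p (q - 1) ++ L.post q ++ E ++ (L.serial l [] (q + 1) qs).flatten := by
  simp [serial, flatten_singles, post]

theorem on_serial {l : ℕ} (hl : l < k) : ∀ (p : ℕ) (qs : List ℕ), Spaced l p qs →
    ∀ g ∈ (L.serial l [] p qs).flatten, L.On (fun i => p ≤ i ∧ i < l) g
  | p, [], h, g, hg => by
    have : p + 1 ≤ l := h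
    rw [serial, flatten_singles] at hg
    exact (L.on_cross (by omega) g hg).mono fun i hi => by omega
  | p, q :: qs, h, g, hg => by
    have h1 := h.1
    have h2 := h.2.lt
    rw [serial_cons_flatten, List.append_nil, List.mem_append, List.mem_append] at hg
    rcases hg with (hg | hg) | hg
    · exact (L.on_cross (by omega) g hg).mono fun i hi => by omega
    · exact (L.on_post (by omega) (by omega) g hg).mono fun i hi => by omega
    · exact (on_serial hl (q + 1) qs h.2 g hg).mono fun i hi => by omega

theorem on_flatMap_pre {l p : ℕ} {qs : List ℕ} (hl : l < k) (h : Spaced l p qs) :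
    ∀ g ∈ qs.flatMap L.pre, L.On (fun i => p + 1 ≤ i ∧ i < l) g := by
  intro g hg
  obtain ⟨q, hq, hg⟩ := List.mem_flatMap.1 hg
  have := h.mem q hq
  exact (L.on_pre (by omega) g hg).mono fun i hi => by omega

theorem mem_hads_wave {qs : List ℕ} {g : Gate k} :
    (g ∈ L.hads qs ++ (L.wave qs).flatten) ↔ g ∈ qs.flatMap L.pre := by
  simp only [hads, wave, pre, List.flatten_cons, List.flatten_nil, List.mem_append, List.mem_map,
    List.mem_flatMap, List.mem_cons, List.not_mem_nil, or_false]
  constructor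
  · rintro (⟨q, hq, rfl⟩ | ⟨q, hq, rfl⟩ | ⟨q, hq, rfl | rfl⟩ | ⟨q, hq, rfl⟩) <;>
      exact ⟨q, hq, by simp⟩
  · rintro ⟨q, hq, rfl | rfl | rfl | rfl | rfl⟩
    · exact Or.inl ⟨q, hq, rfl⟩
    · exact Or.inr (Or.inl ⟨q, hq, rfl⟩)
    · exact Or.inr (Or.inr (Or.inl ⟨q, hq, Or.inl rfl⟩))
    · exact Or.inr (Or.inr (Or.inl ⟨q, hq, Or.inr rfl⟩))
    · exact Or.inr (Or.inr (Or.inr ⟨q, hq, rfl⟩))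

theorem commute_ev {P Q : ℕ → Prop} {A B : List (Gate k)} (hA : ∀ g ∈ A, L.On P g)
    (hB : ∀ g ∈ B, L.On Q g) (h : ∀ i, P i → ¬ Q i) : Commute (ev A) (ev B) := by
  have := ev_swap (A := A) (B := B) fun g hg g' hg' => (hA g hg).indep (hB g' hg') h
  rw [ev_append, ev_append] at this
  exact this.symm

/-- The rearrangement of operators behind the parallel execution of gadgets. -/
theorem mul_four_comm {M : Type*} [Monoid M] {A B T H a b t h : M} (cA : a * H = H * a)
    (cT : t * (A * H) = A * H * t) (cB : b * (T * (A * H)) = T * (A * H) * b) :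
    B * b * (T * t) * (A * a) * (H * h) = B * (T * (A * H)) * (b * (t * (a * h))) := by
  calc B * b * (T * t) * (A * a) * (H * h) = B * b * T * t * A * (a * H) * h := by
        simp only [mul_assoc]
    _ = B * b * T * (t * (A * H)) * a * h := by rw [cA]; simp only [mul_assoc]
    _ = B * (b * (T * (A * H))) * t * a * h := by rw [cT]; simp only [mul_assoc]
    _ = _ := by rw [cB]; simp only [mul_assoc]

/-- Executing the first halves of the gadgets in parallel. -/
theorem ev_hads_wave {l : ℕ} (hl : l < k) : ∀ (p : ℕ) (qs : List ℕ), Spaced l p qs →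
    ev (L.hads qs ++ (L.wave qs).flatten) = ev (qs.flatMap L.pre)
  | _, [], _ => rfl
  | p, q :: qs, h => by
    have ih := ev_hads_wave hl (q + 1) qs h.2
    have h2 := h.2.lt
    have honq : ∀ g ∈ L.hads qs ++ (L.wave qs).flatten, L.On (fun i => q + 1 + 1 ≤ i ∧ i < l) g :=
      fun g hg => L.on_flatMap_pre hl h.2 g (L.mem_hads_wave.1 hg)
    simp only [hads, wave, List.flatten_cons, List.flatten_nil, List.append_nil,
      List.mem_append] at ih honq
    simp only [hads, wave, List.flatten_cons, List.flatten_nil, List.append_nil, List.map_cons,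
      List.flatMap_cons]
    generalize (qs.map fun q => (Gate.h (L.pos (q + 1)) : Gate k)) = H at ih honq
    generalize (qs.map fun q => L.cx (q + 1) q) = A at ih honq
    generalize (qs.flatMap fun q => [Gate.t (L.pos (q + 1)), .tdg (L.pos q)]) = T at ih honq
    generalize (qs.map fun q => L.cx q (q + 1)) = B at ih honq
    have hon := L.on_pre (q := q) (by omega)
    have comm : ∀ X Y : List (Gate k), (∀ g ∈ X, g ∈ L.pre q) →
        (∀ g ∈ Y, g ∈ H ∨ g ∈ A ∨ g ∈ T ∨ g ∈ B) → Commute (ev X) (ev Y) :=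
      fun X Y hX hY => L.commute_ev (fun g hg => hon g (hX g hg)) (fun g hg => honq g (hY g hg))
        fun i hi => by omega
    have hpre : L.pre q = [.h (L.pos (q + 1))] ++ [L.cx (q + 1) q] ++
        [.t (L.pos (q + 1)), .tdg (L.pos q)] ++ [L.cx q (q + 1)] := rfl
    have cA : Commute (ev [L.cx (q + 1) q]) (ev H) :=
      comm _ _ (by simp [pre]) fun _ hg => Or.inl hg
    have cT : Commute (ev [.t (L.pos (q + 1)), .tdg (L.pos q)]) (ev (H ++ A)) :=
      comm _ _ (by simp [pre]) (by simp; tauto)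
    have cB : Commute (ev [L.cx q (q + 1)]) (ev (H ++ A ++ T)) :=
      comm _ _ (by simp [pre]) (by simp; tauto)
    simp only [ev_append, mul_assoc] at cA cT cB ih
    rw [hpre, ev_append _ (qs.flatMap _), ← ih]
    calc ev (.h (L.pos (q + 1)) :: H ++ (L.cx (q + 1) q :: A ++
          ([.t (L.pos (q + 1)), .tdg (L.pos q)] ++ T ++ L.cx q (q + 1) :: B)))
        = ev (([.h (L.pos (q + 1))] ++ H) ++ (([L.cx (q + 1) q] ++ A) ++
          (([.t (L.pos (q + 1)), .tdg (L.pos q)] ++ T) ++ ([L.cx q (q + 1)] ++ B)))) := rfl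
      _ = _ := by
        simp only [ev_append]
        exact mul_four_comm cA.eq cT.eq cB.eq

/-- The time slots of a chain perform the chain. -/
theorem ev_slots {l : ℕ} (hl : l < k) : ∀ (p : ℕ) (qs : List ℕ), Spaced l p qs →
    ev (L.hads qs ++ (L.half l [] p qs).flatten) = ev (L.chain l p qs) := by
  have key : ∀ (p : ℕ) (qs : List ℕ), Spaced l p qs →
      ev (qs.flatMap L.pre ++ (L.serial l [] p qs).flatten) = ev (L.chain l p qs) := by
    intro p qs
    induction qs generalizing p with
    | nil => intro _; simp [serial, flatten_singles, chain]
    | cons q qs ih =>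
      intro h
      have h1 := h.1
      have h2 := h.2.lt
      have c1 : Commute (ev (L.cross p (q - 1) ++ L.post q)) (ev (qs.flatMap L.pre)) := by
        refine L.commute_ev (P := fun i => i ≤ q + 1) (fun g hg => ?_)
          (L.on_flatMap_pre hl h.2) fun i hi => by omega
        rcases List.mem_append.1 hg with hg | hg
        · exact (L.on_cross (by omega) g hg).mono fun i hi => by omega
        · exact (L.on_post (by omega) (by omega) g hg).mono fun i hi => by omega
      have c2 : Commute (ev (L.pre q)) (ev (L.cross p (q - 1))) :=
        L.commute_ev (L.on_pre (by omega)) (L.on_cross (by omega)) fun i hi => by omega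
      have ih := ih _ h.2
      rw [serial_cons_flatten, List.append_nil, List.flatMap_cons, chain]
      simp only [ev_append] at c1 c2 ih ⊢
      rw [← ih]
      calc _ = ev (L.serial l [] (q + 1) qs).flatten *
            (ev (L.post q) * ev (L.cross p (q - 1)) * ev (qs.flatMap L.pre)) * ev (L.pre q) := by
            simp only [mul_assoc]
        _ = ev (L.serial l [] (q + 1) qs).flatten * ev (qs.flatMap L.pre) * ev (L.post q) *
            (ev (L.cross p (q - 1)) * ev (L.pre q)) := by rw [c1.eq]; simp only [mul_assoc]
        _ = _ := by rw [← c2.eq]; simp only [mul_assoc]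
  intro p qs h
  rw [← key p qs h, half, List.flatten_append, ← List.append_assoc, ev_append,
    L.ev_hads_wave hl p qs h, ← ev_append]

/-- The gates in `E` may as well be executed at the end. -/
theorem ev_half_extra {l : ℕ} (hl : l < k) {E : List (Gate k)}
    (hE : ∀ g ∈ E, L.On (fun i => l ≤ i) g) (p : ℕ) {qs : List ℕ} (hqs : qs ≠ [])
    (h : Spaced l p qs) :
    ev (L.half l E p qs).flatten = ev ((L.half l [] p qs).flatten ++ E) := by
  cases qs with
  | nil => exact absurd rfl hqs
  | cons q qs =>
    have c : Commute (ev E) (ev (L.serial l [] (q + 1) qs).flatten) :=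
      L.commute_ev hE (L.on_serial hl _ _ h.2) fun i hi => by omega
    simp only [half, List.flatten_append, serial_cons_flatten, List.append_nil, ev_append]
    rw [← mul_assoc, ← c.eq]
    simp only [mul_assoc]

end Line

/-! ### Diagonal sign operators -/

/-- `A` multiplies the basis state `|x⟩` by `d x`. -/
def Diag {k : ℕ} (A : Op k) (d : (Fin k → Fin 2) → ℂ) : Prop := ∀ x, A *ᵥ ket x = d x • ket x

namespace Line

variable {k : ℕ} (L : Line k)

/-- All gates of the time slots that conjugate a CNOT gate by a chain. -/
noncomputable def signList (l : ℕ) (E : List (Gate k)) (p : ℕ) (qs : List ℕ) : List (Gate k) :=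
  L.hads qs ++ (L.core l E p qs).flatten ++ invL (L.hads qs)

theorem signList_eq (l : ℕ) (E : List (Gate k)) (p : ℕ) (qs : List ℕ) :
    L.signList l E p qs = (L.hads qs ++ (L.half l E p qs).flatten) ++ [L.cx (l - 1) l] ++
      invL (L.hads qs ++ (L.half l E p qs).flatten) := by
  simp [signList, core, flatten_invS, invL_append]

theorem h_mul_self (q : Fin k) : (Gate.h q).toOp * (Gate.h q).toOp = 1 :=
  Gate.inv_toOp_mul (Gate.h q)

/-- A CNOT gate between Hadamard gates on its target is a controlled sign. -/
theorem diag_cz {l : ℕ} (h1 : 1 ≤ l) (hl : l < k) :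
    Diag (ev [.h (L.pos l), L.cx (l - 1) l, .h (L.pos l)])
      fun x => ph (-1) (x (L.pos (l - 1)) * x (L.pos l)) := by
  intro x
  have hne := L.pos_ne (i := l - 1) (j := l) (by omega) hl (by omega)
  have hs := sqrt_two_inv_mul_self
  rw [L.cx_eq (by omega) hl (by omega)]
  simp only [ev_cons_mulVec, ev_nil, one_mulVec, h_ket, mulVec_smul, mulVec_add, cnot_ket,
    update_self, update_idem, update_of_ne hne]
  have hx : ket x = ket (update x (L.pos l) (x (L.pos l))) := by rw [update_eq_self]
  rw [hx]
  generalize x (L.pos (l - 1)) = a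
  generalize x (L.pos l) = b
  generalize (Real.sqrt 2 : ℂ)⁻¹ = s at hs
  ext y
  fin_cases a <;> fin_cases b <;> simp [ph] <;>
    generalize ket (update x (L.pos l) 0) y = u <;> generalize ket (update x (L.pos l) 1) y = v
  all_goals
    first
    | linear_combination (2 * u) * hs
    | linear_combination (2 * v) * hs
    | linear_combination (-2 * v) * hs

/-- A diagonal operator conjugated by a permutation of the basis states with phases is diagonal
again: the phases cancel. -/
theorem diag_conj {U A : List (Gate k)} {π : (Fin k → Fin 2) → Fin k → Fin 2}
    {d : (Fin k → Fin 2) → ℂ} (hU : Mono (ev U) π) (hA : Diag (ev A) d) :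
    Diag (ev (U ++ A ++ invL U)) fun x => d (π x) := by
  intro x
  obtain ⟨c, hc⟩ := hU x
  rw [ev_append, ev_append, ← mulVec_mulVec, ← mulVec_mulVec, hc, mulVec_smul, hA, smul_smul,
    mul_comm, ← smul_smul, ← hc, mulVec_smul, mulVec_mulVec, ev_invL_mul, one_mulVec]

/-- With the Hadamard gates on index `l` inside the chain. -/
theorem ev_signList_had {l : ℕ} (hl : l < k) {p : ℕ} {qs : List ℕ} (hqs : qs ≠ [])
    (h : Spaced l p qs) :
    ev (L.signList l [.h (L.pos l)] p qs) = ev (L.chain l p qs ++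
      [.h (L.pos l), L.cx (l - 1) l, .h (L.pos l)] ++ invL (L.chain l p qs)) := by
  have e1 : ev (L.hads qs ++ (L.half l [.h (L.pos l)] p qs).flatten) =
      ev (L.chain l p qs ++ [.h (L.pos l)]) := by
    rw [ev_append, L.ev_half_extra hl (fun g hg => ?_) p hqs h, ev_append, ev_append _ [_],
      ← L.ev_slots hl p qs h, ev_append, mul_assoc]
    rw [List.mem_singleton] at hg
    exact L.on_of_qubits (i := l) hl le_rfl (by rw [hg]; rfl)
  have e2 := ev_invL_congr e1
  have e3 : invL [(.h (L.pos l) : Gate k)] = [.h (L.pos l)] := rfl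
  have e4 : ([.h (L.pos l), L.cx (l - 1) l, .h (L.pos l)] : List (Gate k)) =
      [.h (L.pos l)] ++ [L.cx (l - 1) l] ++ [.h (L.pos l)] := rfl
  rw [signList_eq, ev_append, ev_append, e1, e2, invL_append, e3, e4]
  simp only [ev_append, mul_assoc]

theorem on_chain {l : ℕ} (hl : l < k) : ∀ (p : ℕ) (qs : List ℕ), Spaced l p qs →
    ∀ g ∈ L.chain l p qs, L.On (fun i => p ≤ i ∧ i < l) g
  | p, [], h, g, hg => by
    have : p + 1 ≤ l := h
    exact (L.on_cross (by omega) g hg).mono fun i hi => by omega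
  | p, q :: qs, h, g, hg => by
    have h1 := h.1
    have h2 := h.2.lt
    rw [chain, List.mem_append, List.mem_append, List.mem_append] at hg
    rcases hg with (hg | hg | hg) | hg
    · exact (L.on_cross (by omega) g hg).mono fun i hi => by omega
    · exact (L.on_pre (by omega) g hg).mono fun i hi => by omega
    · exact (L.on_post (by omega) (by omega) g hg).mono fun i hi => by omega
    · exact (on_chain hl (q + 1) qs h.2 g hg).mono fun i hi => by omega

theorem invL_on {P : ℕ → Prop} {A : List (Gate k)} (hA : ∀ g ∈ A, L.On P g) :
    ∀ g ∈ invL A, L.On P g := by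
  intro g hg
  simp only [invL, List.mem_reverse, List.mem_map] at hg
  obtain ⟨g', hg', rfl⟩ := hg
  exact (hA g' hg').inv

/-- With the Hadamard gates on index `l` before and after everything else. -/
theorem ev_signList_nil {l : ℕ} (hl : l < k) {p : ℕ} {qs : List ℕ} (h : Spaced l p qs) :
    ev ([.h (L.pos l)] ++ L.signList l [] p qs ++ [.h (L.pos l)]) = ev (L.chain l p qs ++
      [.h (L.pos l), L.cx (l - 1) l, .h (L.pos l)] ++ invL (L.chain l p qs)) := by
  have e1 := L.ev_slots hl p qs h
  have e2 := ev_invL_congr e1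
  have hh : ∀ g ∈ ([.h (L.pos l)] : List (Gate k)), L.On (fun i => l ≤ i) g := by
    intro g hg
    rw [List.mem_singleton] at hg
    exact L.on_of_qubits (i := l) hl le_rfl (by rw [hg]; rfl)
  have c1 := L.commute_ev hh (L.on_chain hl p qs h) fun i hi => by omega
  have c2 := L.commute_ev hh (L.invL_on (L.on_chain hl p qs h)) fun i hi => by omega
  have e4 : ([.h (L.pos l), L.cx (l - 1) l, .h (L.pos l)] : List (Gate k)) =
      [.h (L.pos l)] ++ [L.cx (l - 1) l] ++ [.h (L.pos l)] := rfl
  rw [signList_eq, ev_append, ev_append, ev_append _ (invL _), ev_append, e1, e2, e4]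
  simp only [ev_append]
  calc _ = (ev [.h (L.pos l)] * ev (invL (L.chain l p qs))) * ev [L.cx (l - 1) l] *
        (ev (L.chain l p qs) * ev [.h (L.pos l)]) := by simp only [mul_assoc]
    _ = _ := by rw [c2.eq, ← c1.eq]; simp only [mul_assoc]

/-- A chain whose sign operator tests whether the qubits with indices in `K` are all `1`, in the
sense that flipping the qubit at `τ` then changes the sign. The qubit at `τ` is either the start
of the chain, or the first factor in the case that the start itself is a control. -/
structure IsClass (k τ l p : ℕ) (qs : List ℕ) (K : Finset ℕ) : Prop where
  lt : l < k
  spaced : Spaced l p qs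
  ne : qs ≠ []
  cases : (p = τ ∧ K = (l :: qs).toFinset) ∨
    (p + 1 = τ ∧ ∃ rest, qs = τ :: rest ∧ K = (p :: l :: rest).toFinset)

variable {L}

theorem IsClass.exists_diag {τ l p : ℕ} {qs : List ℕ} {K : Finset ℕ}
    (h : IsClass k τ l p qs K) :
    ∃ d : (Fin k → Fin 2) → ℂ, Diag (ev (L.signList l [.h (L.pos l)] p qs)) d ∧
      Diag (ev ([.h (L.pos l)] ++ L.signList l [] p qs ++ [.h (L.pos l)])) d ∧
      (∀ x, d x * d x = 1) ∧
      ∀ x, d (update x (L.pos τ) (x (L.pos τ) + 1)) =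
        d x * ph (-1) (if ∀ i ∈ K, x (L.pos i) = 1 then 1 else 0) := by
  have hl := h.lt
  have hsp := h.spaced
  have hlt := hsp.lt
  have hm := hsp.mem
  obtain ⟨π, h1, h2, h3⟩ : ∃ π, Mono (ev (L.chain l p qs)) π ∧
      (∀ x i, i < k → l ≤ i → π x (L.pos i) = x (L.pos i)) ∧
      ∀ x, ph (-1) (π (update x (L.pos τ) (x (L.pos τ) + 1)) (L.pos (l - 1)) *
        update x (L.pos τ) (x (L.pos τ) + 1) (L.pos l)) =
        ph (-1) (π x (L.pos (l - 1)) * x (L.pos l)) *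
          ph (-1) (if ∀ i ∈ K, x (L.pos i) = 1 then 1 else 0) := by
    have key : ∀ (u v w : Fin 2) (P Q : Prop) [Decidable P] [Decidable Q],
        v = u + (if P then 1 else 0) → (Q ↔ w = 1 ∧ P) →
        ph (-1) (v * w) = ph (-1) (u * w) * ph (-1) (if Q then 1 else 0) := by
      intro u v w P Q _ _ hv hQ
      subst hv
      by_cases hP : P <;> fin_cases w <;> fin_cases u <;> simp [hP, hQ, ph]
    rcases h.cases with ⟨rfl, rfl⟩ | ⟨rfl, rest, rfl, rfl⟩
    · obtain ⟨π, h1, h2, h3⟩ := L.mono_chain hl p qs hsp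
      refine ⟨π, h1, h2, fun x => ?_⟩
      have e := h3 x (update x (L.pos p) (x (L.pos p) + 1)) 1
        (fun i hi hpi => update_of_ne (L.pos_ne hi (by omega) (by omega)) _ _) (update_self _ _ _)
      rw [update_of_ne (L.pos_ne hl (by omega) (by omega))]
      exact key _ _ _ _ _ e (by simp)
    · obtain ⟨π, h1, h2, h3⟩ := L.mono_chain_succ hl p rest hsp
      have := hm (p + 1) (by simp)
      refine ⟨π, h1, h2, fun x => ?_⟩
      have e := h3 x (update x (L.pos (p + 1)) (x (L.pos (p + 1)) + 1)) 1
        (fun i hi hpi => update_of_ne (L.pos_ne hi (by omega) (by omega)) _ _) (update_self _ _ _)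
      rw [update_of_ne (L.pos_ne hl (by omega) (by omega))]
      refine key _ _ _ _ _ e ?_
      simp only [List.toFinset_cons, Finset.mem_insert, List.mem_toFinset, forall_eq_or_imp,
        List.mem_cons]
      tauto
  have hd := diag_conj h1 (L.diag_cz (by omega) hl)
  have hd' : Diag (ev (L.chain l p qs ++ [.h (L.pos l), L.cx (l - 1) l, .h (L.pos l)] ++
      invL (L.chain l p qs))) fun x => ph (-1) (π x (L.pos (l - 1)) * x (L.pos l)) := by
    intro x
    rw [hd x]
    simp only [h2 x l hl le_rfl]
  refine ⟨fun x => ph (-1) (π x (L.pos (l - 1)) * x (L.pos l)), ?_, ?_, ?_, h3⟩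
  · rw [L.ev_signList_had hl h.ne hsp]; exact hd'
  · rw [L.ev_signList_nil hl hsp]; exact hd'
  · intro x
    simp only [ph]
    split_ifs <;> norm_num

end Line

/-! ### The commutator of rotations with sign operators -/

section word
variable {k : ℕ}

/-- The vector `u` of the qubit `t`, the other qubits being in the state `x`. -/
noncomputable def qvec (t : Fin k) (x : Fin k → Fin 2) (u : Fin 2 → ℂ) : (Fin k → Fin 2) → ℂ :=
  ∑ b, u b • ket (update x t b)

theorem ket_eq_qvec (t : Fin k) (x : Fin k → Fin 2) : ket x = qvec t x (Pi.single (x t) 1) := by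
  simp [qvec, Pi.single_apply, ite_smul]

theorem controlled_qvec {C : Finset (Fin k)} {t : Fin k} (ht : t ∉ C)
    (U : Matrix (Fin 2) (Fin 2) ℂ) (x : Fin k → Fin 2) (u : Fin 2 → ℂ) :
    controlled C t U *ᵥ qvec t x u = qvec t x (ctlMat C U x *ᵥ u) := by
  simp only [qvec, mulVec_sum, mulVec_smul, controlled_ket, ctlMat_update _ _ ht, update_self,
    update_idem, Finset.smul_sum, smul_smul]
  rw [Finset.sum_comm]
  refine Finset.sum_congr rfl fun b _ => ?_
  rw [← Finset.sum_smul]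
  congr 1
  exact Finset.sum_congr rfl fun _ _ => mul_comm _ _

/-- The Pauli matrix `Z`. -/
def matZ : Matrix (Fin 2) (Fin 2) ℂ := !![1, 0; 0, -1]

theorem matZ_conj_matRx (θ : ℝ) : matZ * matRx θ * matZ = matRx (-θ) := by
  ext i j
  fin_cases i <;> fin_cases j <;> simp [matZ, matRx, neg_div]

theorem matZ_mul_self : matZ * matZ = 1 := by
  ext i j
  fin_cases i <;> fin_cases j <;> simp [matZ]

theorem diag_qvec {A : Op k} {d : (Fin k → Fin 2) → ℂ} (hA : Diag A d) {t : Fin k}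
    {C : Finset (Fin k)} (ht : t ∉ C)
    (hd : ∀ x, d (update x t (x t + 1)) = d x * ph (-1) (if ∀ i ∈ C, x i = 1 then 1 else 0))
    (x : Fin k → Fin 2) (u : Fin 2 → ℂ) :
    A *ᵥ qvec t x u = qvec t x ((d (update x t 0) • ctlMat C matZ x) *ᵥ u) := by
  have hd := hd (update x t 0)
  have hiff : (∀ i ∈ C, update x t 0 i = 1) ↔ ∀ i ∈ C, x i = 1 :=
    forall₂_congr fun i hi => by rw [update_of_ne (ne_of_mem_of_not_mem hi ht)]
  rw [update_self, update_idem, zero_add, if_congr hiff rfl rfl] at hd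
  simp only [qvec, mulVec_add, mulVec_smul, hA _, Fin.sum_univ_two, ctlMat, smul_smul,
    smul_mulVec, Pi.smul_apply]
  by_cases hC : ∀ i ∈ C, x i = 1
  · rw [if_pos hC] at hd ⊢
    simp [hd, ph, matZ, mul_comm, Matrix.mulVec, dotProduct, Fin.sum_univ_two]
  · rw [if_neg hC] at hd ⊢
    simp [hd, ph, mul_comm]

/-- The commutator on the target qubit, for fixed values of the other qubits. -/
theorem commutator_matRx (α : ℝ) (s₁ s₂ : ℂ) (h₁ : s₁ * s₁ = 1) (h₂ : s₂ * s₂ = 1)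
    (P Q : Prop) [Decidable P] [Decidable Q] :
    matRx (-α) * (s₂ • if Q then matZ else 1) * matRx α * (s₁ • if P then matZ else 1) *
      (matRx (-α) * (s₂ • if Q then matZ else 1) * matRx α * (s₁ • if P then matZ else 1)) =
      if P ∧ Q then matRx (-4 * α) else 1 := by
  have hs : ∀ A B : Matrix (Fin 2) (Fin 2) ℂ, matRx (-α) * (s₂ • A) * matRx α * (s₁ • B) *
      (matRx (-α) * (s₂ • A) * matRx α * (s₁ • B)) =
      matRx (-α) * A * matRx α * B * (matRx (-α) * A * matRx α * B) := by
    intro A B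
    simp only [Matrix.mul_smul, Matrix.smul_mul, smul_smul]
    rw [show s₁ * s₂ * (s₁ * s₂) = (s₁ * s₁) * (s₂ * s₂) by ring, h₁, h₂, one_mul, one_smul]
  have hz : ∀ θ : ℝ, matZ * matRx θ = matRx (-θ) * matZ := by
    intro θ
    rw [← matZ_conj_matRx, mul_assoc, matZ_mul_self, mul_one]
  -- The signs `s₁` and `s₂` occur twice each and drop out.
  rw [hs]
  have e1 : matRx (-α) * matRx α = 1 := by rw [matRx_mul, neg_add_cancel, matRx_zero]
  have e2 : matRx α * matRx (-α) = 1 := by rw [matRx_mul, add_neg_cancel, matRx_zero]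
  by_cases hP : P <;> by_cases hQ : Q <;> simp only [hP, hQ, if_true, if_false, and_self,
    and_true, and_false, mul_one]
  · calc _ = matRx (-α) * (matZ * matRx α) * matZ * (matRx (-α) * (matZ * matRx α) * matZ) := by
          simp only [mul_assoc]
      _ = matRx (-α) * matRx (-α) * (matZ * matZ) * (matRx (-α) * matRx (-α) * (matZ * matZ)) := by
          rw [hz]; simp only [mul_assoc]
      _ = _ := by
          rw [matZ_mul_self, mul_one, matRx_mul, matRx_mul]
          congr 1
          ring
  · rw [e1, one_mul, matZ_mul_self]
  · calc _ = matRx (-α) * (matZ * (matRx α * matRx (-α)) * matZ) * matRx α := by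
          simp only [mul_assoc]
      _ = 1 := by rw [e2, mul_one, matZ_mul_self, mul_one, e1]
  · rw [e1, one_mul]

/-- If flipping the qubit `t` changes the sign of `A₁` exactly when all qubits in `C₁` are `1`,
and similarly for `A₂` and `C₂`, then a commutator of `A₁` and `A₂` with rotations of `t` is a
rotation controlled by all these qubits. What else the signs depend on cancels. -/
theorem commutator_eq_controlled {A₁ A₂ : Op k} {d₁ d₂ : (Fin k → Fin 2) → ℂ} {t : Fin k}
    {C₁ C₂ : Finset (Fin k)} (hA₁ : Diag A₁ d₁) (hA₂ : Diag A₂ d₂) (ht₁ : t ∉ C₁) (ht₂ : t ∉ C₂)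
    (hd₁ : ∀ x, d₁ (update x t (x t + 1)) = d₁ x * ph (-1) (if ∀ i ∈ C₁, x i = 1 then 1 else 0))
    (hd₂ : ∀ x, d₂ (update x t (x t + 1)) = d₂ x * ph (-1) (if ∀ i ∈ C₂, x i = 1 then 1 else 0))
    (hs₁ : ∀ x, d₁ x * d₁ x = 1) (hs₂ : ∀ x, d₂ x * d₂ x = 1) (α : ℝ) :
    (Gate.rx (-α) t).toOp * A₂ * (Gate.rx α t).toOp * A₁ *
      ((Gate.rx (-α) t).toOp * A₂ * (Gate.rx α t).toOp * A₁) =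
      controlled (C₁ ∪ C₂) t (matRx (-4 * α)) := by
  classical
  apply op_ext
  intro x
  have hR : ∀ θ u, (Gate.rx θ t).toOp *ᵥ qvec t x u = qvec t x (matRx θ *ᵥ u) := by
    intro θ u
    rw [Gate.toOp, single, controlled_qvec (Finset.notMem_empty t)]
    simp [ctlMat]
  rw [ket_eq_qvec t x, controlled_qvec (by simp [ht₁, ht₂])]
  simp only [← mulVec_mulVec, hR, diag_qvec hA₁ ht₁ hd₁, diag_qvec hA₂ ht₂ hd₂]
  simp only [mulVec_mulVec]
  congr 2
  have := commutator_matRx α _ _ (hs₁ (update x t 0)) (hs₂ (update x t 0))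
    (∀ i ∈ C₁, x i = 1) (∀ i ∈ C₂, x i = 1)
  simp only [ctlMat, Finset.mem_union, or_imp, forall_and]
  simp only [← mul_assoc] at this ⊢
  convert this

end word

/-! ### Moving the target along the line -/

namespace Line

variable {k : ℕ} (L : Line k)

/-- Two CNOT gates that move the target from index `j` to index `j - 1`: the bit at `j - 1` moves
to `j` and is also added to the target. -/
noncomputable def step (j : ℕ) : List (Gate k) := [L.cx j (j - 1), L.cx (j - 1) j]

/-- The steps that move the target from index `a` to index `1`. -/
noncomputable def move : ℕ → List (Gate k)
  | 0 => []
  | 1 => []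
  | a + 2 => L.step (a + 2) ++ move (a + 1)

theorem matRx_add_add (φ : ℝ) (a b e : Fin 2) : matRx φ (a + e) (b + e) = matRx φ a b := by
  fin_cases a <;> fin_cases b <;> fin_cases e <;> simp [matRx]

/-- Conjugation by two CNOT gates that exchange the qubits `c` and `d`, up to the addition of the
second bit to the first one. This addition does not matter, since `R_x` commutes with the Pauli
matrix `X`. -/
theorem two_cnot_conj {c d : Fin k} (hne : c ≠ d) {C : Finset (Fin k)} (hC : c ∉ C) (φ : ℝ) :
    ev [.cnot d c hne.symm, .cnot c d hne] *
      (controlled (C.map (Equiv.swap c d).toEmbedding) d (matRx φ) *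
        ev [.cnot c d hne, .cnot d c hne.symm]) = controlled C c (matRx φ) := by
  apply op_ext
  intro x
  simp only [← mulVec_mulVec, ev_cons_mulVec, ev_nil, one_mulVec, cnot_ket, controlled_ket,
    mulVec_sum, mulVec_smul, update_self, update_of_ne hne, update_of_ne hne.symm]
  have hctl : ctlMat (C.map (Equiv.swap c d).toEmbedding) (matRx φ)
      (update (update x d (x d + x c)) c (x c + (x d + x c))) = ctlMat C (matRx φ) x := by
    have : (∀ i ∈ C.map (Equiv.swap c d).toEmbedding,
        update (update x d (x d + x c)) c (x c + (x d + x c)) i = 1) ↔ ∀ i ∈ C, x i = 1 := by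
      rw [Finset.forall_mem_map]
      refine forall₂_congr fun i hi => ?_
      have hic : i ≠ c := ne_of_mem_of_not_mem hi hC
      simp only [Equiv.coe_toEmbedding]
      by_cases hid : i = d
      · subst hid
        rw [Equiv.swap_apply_right, update_self]
        generalize x i = u
        generalize x c = v
        revert u v; decide
      · rw [Equiv.swap_apply_of_ne_of_ne hic hid, update_of_ne hic, update_of_ne hid]
    simp only [ctlMat, this]
  have hM : ∀ a b e : Fin 2, ctlMat C (matRx φ) x (a + e) (b + e) = ctlMat C (matRx φ) x a b := by
    intro a b e
    unfold ctlMat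
    split_ifs
    · exact matRx_add_add φ a b e
    · fin_cases a <;> fin_cases b <;> fin_cases e <;> simp
  simp only [hctl]
  refine (Fintype.sum_equiv (Equiv.addRight (x d)) _ _ fun b => ?_).symm
  rw [Equiv.coe_addRight]
  congr 1
  · rw [← hM b (x c) (x d), add_comm (x d)]
  · congr 1
    ext i
    by_cases hic : i = c
    · subst hic
      simp only [update_self, update_of_ne hne]
      generalize x d = u
      generalize x i = v
      revert b u v; decide
    · by_cases hid : i = d
      · subst hid
        simp only [update_self, update_of_ne hne.symm]
        generalize x i = u
        generalize x c = v
        revert b u v; decide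
      · simp [hic, hid]

theorem ev_step_conj {j : ℕ} (h1 : 1 ≤ j) (hj : j < k) {C : Finset (Fin k)} (hC : L.pos j ∉ C)
    (φ : ℝ) {W : List (Gate k)}
    (hW : ev W = controlled (C.map (Equiv.swap (L.pos j) (L.pos (j - 1))).toEmbedding)
      (L.pos (j - 1)) (matRx φ)) :
    ev (L.step j ++ W ++ invL (L.step j)) = controlled C (L.pos j) (matRx φ) := by
  have hinv : invL (L.step j) = [L.cx (j - 1) j, L.cx j (j - 1)] := by simp [invL, step]
  rw [ev_append, ev_append, hinv, hW, step, L.cx_eq hj (by omega) (by omega),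
    L.cx_eq (by omega) hj (by omega)]
  exact two_cnot_conj (L.pos_ne hj (by omega) (by omega)) hC φ

/-- After the move the bits of the controls are at new places, the set `C'`; index `1` holds the
target, added to other bits. -/
theorem exists_move_conj : ∀ {a : ℕ}, 1 ≤ a → a < k → ∀ {C : Finset (Fin k)}, L.pos a ∉ C →
    ∃ C' : Finset (Fin k), C'.card = C.card ∧ L.pos 1 ∉ C' ∧ ∀ (φ : ℝ) (W : List (Gate k)),
      ev W = controlled C' (L.pos 1) (matRx φ) →
      ev (L.move a ++ W ++ invL (L.move a)) = controlled C (L.pos a) (matRx φ)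
  | 0, h, _, _, _ => absurd h (by omega)
  | 1, _, _, C, hC => ⟨C, rfl, hC, fun φ W hW => by simpa [move, invL] using hW⟩
  | a + 2, _, ha, C, hC => by
    have hmem : L.pos (a + 1) ∉ C.map (Equiv.swap (L.pos (a + 2)) (L.pos (a + 1))).toEmbedding := by
      rw [Finset.mem_map_equiv, Equiv.symm_swap, Equiv.swap_apply_right]
      exact hC
    obtain ⟨C', h1, h2, h3⟩ := exists_move_conj (a := a + 1) (by omega) (by omega) hmem
    refine ⟨C', by rw [h1, Finset.card_map], h2, fun φ W hW => ?_⟩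
    have := L.ev_step_conj (j := a + 2) (by omega) ha hC φ (h3 φ W hW)
    rw [move, invL_append]
    simpa only [List.append_assoc] using this

/-- The middle part of the parallel execution of the steps: the first gate of a step is executed
together with the second gate of the step before the previous one. -/
noncomputable def moveBody : ℕ → List (List (Gate k))
  | 0 => []
  | 1 => []
  | j + 2 => [L.cx (j + 2) (j + 1), L.cx (j + 3) (j + 4)] :: moveBody (j + 1)

/-- The time slots that move the target from index `a` to index `1`. -/
noncomputable def moveSlots : ℕ → List (List (Gate k))
  | 0 => []
  | 1 => []
  | 2 => [[L.cx 2 1], [L.cx 1 2]]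
  | a + 3 => [L.cx (a + 3) (a + 2)] :: [L.cx (a + 2) (a + 1)] ::
      (moveBody L (a + 1) ++ [[L.cx 2 3], [L.cx 1 2]])

theorem indep_cx_of_eq {i j j' : ℕ} (hi : i < k) (hj : j < k) (hj' : j' < k) (h : i ≠ j)
    (h' : i ≠ j') (hjj : j ≠ j') : (L.cx i j).Indep (L.cx i j') := by
  have h1 := L.pos_ne hi hj h
  have h2 := L.pos_ne hi hj' h'
  have h3 := L.pos_ne hj hj' hjj
  rw [L.cx_eq hi hj h, L.cx_eq hi hj' h']
  simp [Gate.Indep, Gate.tgt, Gate.qubits, h1.symm, h2.symm, h3, h3.symm]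

/-- The parallel execution only exchanges gates on disjoint qubits and CNOT gates with a common
control. -/
theorem ev_moveSlots {a : ℕ} (ha : a < k) : ev (L.moveSlots a).flatten = ev (L.move a) := by
  match a, ha with
  | 0, _ => rfl
  | 1, _ => rfl
  | 2, _ => rfl
  | a + 3, ha =>
    simp only [moveSlots, List.flatten_cons, List.flatten_append]
    induction a with
    | zero =>
      have := ev_swap (A := [L.cx 2 1]) (B := [L.cx 2 3]) (by
        simp only [List.mem_singleton, forall_eq]
        exact L.indep_cx_of_eq (by omega) (by omega) (by omega) (by omega) (by omega) (by omega))
      calc _ = ev ([L.cx 3 2] ++ (([L.cx 2 1] ++ [L.cx 2 3]) ++ [L.cx 1 2])) := rfl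
        _ = ev ([L.cx 3 2] ++ (([L.cx 2 3] ++ [L.cx 2 1]) ++ [L.cx 1 2])) := by
          rw [ev_append, ev_append _ [L.cx 1 2], this, ← ev_append, ← ev_append]
        _ = _ := rfl
    | succ a ih =>
      have ih := ih (by omega)
      have hsw := ev_swap (A := [L.cx (a + 3) (a + 2), L.cx (a + 2) (a + 1)])
        (B := [L.cx (a + 3) (a + 4)]) (by
          intro g hg g' hg'
          rw [List.mem_singleton] at hg'
          subst hg'
          simp only [List.mem_cons, List.not_mem_nil, or_false] at hg
          rcases hg with rfl | rfl
          · exact L.indep_cx_of_eq (by omega) (by omega) (by omega) (by omega) (by omega)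
              (by omega)
          · exact (L.on_cx (P := fun i => i ≤ a + 2) (by omega) (by omega) (by omega) (by omega)
              (by omega)).indep (L.on_cx (P := fun i => a + 3 ≤ i) (by omega) (by omega)
              (by omega) (by omega) (by omega)) fun i hi => by omega)
      have e : L.move (a + 1 + 3) = [L.cx (a + 4) (a + 3), L.cx (a + 3) (a + 4)] ++
          L.move (a + 3) := rfl
      rw [e, ev_append _ (L.move _), ← ih]
      generalize [L.cx 2 3] ++ ([L.cx 1 2] ++ ([] : List (List (Gate k))).flatten) = X
      calc _ = ev ([L.cx (a + 4) (a + 3)] ++ (([L.cx (a + 3) (a + 2), L.cx (a + 2) (a + 1)] ++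
            [L.cx (a + 3) (a + 4)]) ++ ((L.moveBody (a + 1)).flatten ++ X))) := by
            simp [moveBody, Nat.add_assoc]
        _ = ev ([L.cx (a + 4) (a + 3)] ++ (([L.cx (a + 3) (a + 4)] ++
            [L.cx (a + 3) (a + 2), L.cx (a + 2) (a + 1)]) ++
            ((L.moveBody (a + 1)).flatten ++ X))) := by
            rw [ev_append, ev_append _ (_ ++ X), hsw, ← ev_append, ← ev_append]
        _ = _ := by
            rw [← ev_append]
            simp

end Line

/-! ### Special unitary matrices as conjugates of rotations -/

theorem exists_polar (a b : ℝ) : ∃ r θ : ℝ, 0 ≤ r ∧ a = r * Real.cos θ ∧ b = r * Real.sin θ := by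
  refine ⟨‖(⟨a, b⟩ : ℂ)‖, Complex.arg ⟨a, b⟩, norm_nonneg _, ?_, ?_⟩
  · rw [Complex.norm_mul_cos_arg]
  · rw [Complex.norm_mul_sin_arg]

/-- The rotation `R_x` is taken to a rotation about any axis by conjugation with some
`R_x(γ) R_z(β)`: in polar coordinates, the axis is `(cos β, sin β cos γ, sin β sin γ)`. -/
theorem exists_eq_conj_matRx {W : Matrix (Fin 2) (Fin 2) ℂ}
    (hW : W ∈ Matrix.specialUnitaryGroup (Fin 2) ℂ) :
    ∃ β γ φ : ℝ, W = matRx γ * matRz β * matRx φ * (matRz (-β) * matRx (-γ)) := by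
  obtain ⟨hU, hdet⟩ := Matrix.mem_specialUnitaryGroup_iff.1 hW
  have hadj : star W = W.adjugate := by
    calc star W = star W * (W * W.adjugate) := by rw [Matrix.mul_adjugate, hdet, one_smul, mul_one]
      _ = W.adjugate := by rw [← mul_assoc, Matrix.mem_unitaryGroup_iff'.1 hU, one_mul]
  rw [Matrix.adjugate_fin_two] at hadj
  have h11 : W 1 1 = (starRingEnd ℂ) (W 0 0) := by
    have := congrFun (congrFun hadj 0) 0
    simpa [Matrix.star_apply] using this.symm
  have h01 : W 0 1 = -(starRingEnd ℂ) (W 1 0) := by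
    have := congrFun (congrFun hadj 0) 1
    simp [Matrix.star_apply] at this
    rw [this, neg_neg]
  rw [Matrix.det_fin_two, h11, h01] at hdet
  generalize hp : W 0 0 = p at *
  generalize hq : W 1 0 = q at *
  have hnorm : p.re ^ 2 + p.im ^ 2 + q.re ^ 2 + q.im ^ 2 = 1 := by
    have := congrArg Complex.re hdet
    simp at this
    linarith
  obtain ⟨r, γ, hr, hγ1, hγ2⟩ := exists_polar q.re (-p.im)
  obtain ⟨s, β, hs, hβ1, hβ2⟩ := exists_polar (-q.im) r
  obtain ⟨u, φ, hu, hφ1, hφ2⟩ := exists_polar p.re s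
  have hu1 : u = 1 := by
    have e1 := Real.cos_sq_add_sin_sq γ
    have e2 := Real.cos_sq_add_sin_sq β
    have e3 := Real.cos_sq_add_sin_sq φ
    have : u ^ 2 = 1 := by
      have r2 : r ^ 2 = q.re ^ 2 + p.im ^ 2 := by
        rw [hγ1, ← neg_sq p.im, hγ2]; linear_combination (-r ^ 2) * e1
      have s2 : s ^ 2 = q.im ^ 2 + r ^ 2 := by
        rw [← neg_sq q.im, hβ1, hβ2]; linear_combination (-s ^ 2) * e2
      have u2 : u ^ 2 = p.re ^ 2 + s ^ 2 := by
        rw [hφ1, hφ2]; linear_combination (-u ^ 2) * e3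
      linarith
    nlinarith
  subst hu1
  rw [one_mul] at hφ1 hφ2
  refine ⟨β, γ, 2 * φ, ?_⟩
  have hp' : p = Real.cos φ - Complex.I * (Real.sin φ * (Real.sin β * Real.sin γ) : ℝ) := by
    apply Complex.ext
    · rw [Complex.sub_re, Complex.ofReal_re, Complex.I_mul_re, Complex.ofReal_im, hφ1, neg_zero,
        sub_zero]
    · simp only [Complex.sub_im, Complex.ofReal_im, Complex.I_mul_im, Complex.ofReal_re]
      rw [← hφ2, ← mul_assoc, ← hβ2, ← hγ2]
      ring
  have hq' : q = (Real.sin φ * (Real.sin β * Real.cos γ) : ℝ) -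
      Complex.I * (Real.sin φ * Real.cos β : ℝ) := by
    apply Complex.ext
    · simp only [Complex.sub_re, Complex.ofReal_re, Complex.I_mul_re, Complex.ofReal_im]
      rw [← mul_assoc, ← hφ2, ← hβ2, ← hγ1, neg_zero, sub_zero]
    · simp only [Complex.sub_im, Complex.ofReal_im, Complex.I_mul_im, Complex.ofReal_re]
      rw [← hφ2, ← hβ1]; ring
  have hI := Complex.I_mul_I
  have hz : matRz β * matRx (2 * φ) * matRz (-β) =
      !![(Real.cos φ : ℂ), -Complex.I * Real.sin φ * Real.cos β - Real.sin φ * Real.sin β;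
        -Complex.I * Real.sin φ * Real.cos β + Real.sin φ * Real.sin β, (Real.cos φ : ℂ)] := by
    have hf : 2 * φ / 2 = φ := by ring
    have hg : -β / 2 = -(β / 2) := by ring
    have e1 : Complex.exp (Complex.I * (β / 2 : ℝ)) * Complex.exp (Complex.I * (β / 2 : ℝ)) =
        Real.cos β + Complex.I * Real.sin β := by
      rw [← Complex.exp_add, Complex.ofReal_cos, Complex.ofReal_sin, mul_comm _ (Complex.sin _),
        ← Complex.exp_mul_I]
      congr 1
      push_cast
      ring
    have e2 : Complex.exp (-Complex.I * (β / 2 : ℝ)) * Complex.exp (-Complex.I * (β / 2 : ℝ)) =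
        Real.cos β - Complex.I * Real.sin β := by
      have : (Real.cos β - Complex.I * Real.sin β : ℂ) =
          Complex.cos (-β) + Complex.sin (-β) * Complex.I := by
        rw [Complex.cos_neg, Complex.sin_neg, Complex.ofReal_cos, Complex.ofReal_sin]
        ring
      rw [← Complex.exp_add, this, ← Complex.exp_mul_I]
      congr 1
      push_cast
      ring
    have e3 : Complex.exp (-Complex.I * (β / 2 : ℝ)) * Complex.exp (Complex.I * (β / 2 : ℝ)) =
        1 := by
      rw [← Complex.exp_add, neg_mul, neg_add_cancel, Complex.exp_zero]
    rw [matRz, matRz, matRx, hf, hg, Complex.ofReal_neg, neg_mul_neg, mul_neg, ← neg_mul]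
    generalize Complex.exp (-Complex.I * (β / 2 : ℝ)) = z at *
    generalize Complex.exp (Complex.I * (β / 2 : ℝ)) = w at *
    generalize (Real.cos β : ℂ) = cb at *
    generalize (Real.sin β : ℂ) = sb at *
    generalize (Real.cos φ : ℂ) = c at *
    generalize (Real.sin φ : ℂ) = s at *
    generalize Complex.I = I at *
    ext i j
    fin_cases i <;> fin_cases j <;> simp [Matrix.mul_apply, Fin.sum_univ_two]
    · linear_combination c * e3
    · linear_combination (-I * s) * e2 + (s * sb) * hI
    · linear_combination (-I * s) * e1 - (s * sb) * hI
    · linear_combination c * e3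
  have hW' : W = !![p, -(starRingEnd ℂ) q; q, (starRingEnd ℂ) p] := by
    ext i j
    fin_cases i <;> fin_cases j <;> simp [*]
  have hg : γ = 2 * (γ / 2) := by ring
  have hs2 : (Real.sin γ : ℂ) = 2 * Real.sin (γ / 2) * Real.cos (γ / 2) := by
    have := Real.sin_two_mul (γ / 2)
    rw [← hg] at this
    exact_mod_cast this
  have hc2 : (Real.cos γ : ℂ) = Real.cos (γ / 2) ^ 2 - Real.sin (γ / 2) ^ 2 := by
    have := Real.cos_two_mul' (γ / 2)
    rw [← hg] at this
    exact_mod_cast this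
  have h1 : (Real.cos (γ / 2) : ℂ) ^ 2 + (Real.sin (γ / 2) : ℂ) ^ 2 = 1 := by
    exact_mod_cast Real.cos_sq_add_sin_sq (γ / 2)
  calc W = matRx γ * (matRz β * matRx (2 * φ) * matRz (-β)) * matRx (-γ) := by
        rw [hz, hW', hp', hq', matRx, matRx, neg_div, Real.cos_neg, Real.sin_neg]
        simp only [map_sub, map_mul, Complex.conj_I, Complex.conj_ofReal, Complex.ofReal_mul,
          Complex.ofReal_neg, hs2, hc2, map_pow, map_ofNat]
        generalize (Real.cos (γ / 2) : ℂ) = cg at *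
        generalize (Real.sin (γ / 2) : ℂ) = sg at *
        generalize (Real.cos β : ℂ) = cb at *
        generalize (Real.sin β : ℂ) = sb at *
        generalize (Real.cos φ : ℂ) = c at *
        generalize (Real.sin φ : ℂ) = s at *
        generalize Complex.I = I at *
        ext i j
        fin_cases i <;> fin_cases j <;> simp [Matrix.mul_apply, Fin.sum_univ_two]
        · linear_combination (-c) * h1 + (sg ^ 2 * c) * hI
        · linear_combination (I * s * cb) * h1 + (sg ^ 2 * (-I * s * cb + s * sb)) * hI
        · linear_combination (I * s * cb) * h1 + (sg ^ 2 * (-I * s * cb - s * sb)) * hI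
        · linear_combination (-c) * h1 + (sg ^ 2 * c) * hI
    _ = _ := by simp only [mul_assoc]

theorem controlled_conj {k : ℕ} {C : Finset (Fin k)} {t : Fin k} (ht : t ∉ C)
    {V R V' : Matrix (Fin 2) (Fin 2) ℂ} (hV : V * V' = 1) :
    single t V * controlled C t R * single t V' = controlled C t (V * R * V') := by
  apply op_ext
  intro x
  rw [single, single, ket_eq_qvec t x]
  simp only [← mulVec_mulVec, controlled_qvec ht, controlled_qvec (Finset.notMem_empty t)]
  simp only [mulVec_mulVec]
  congr 2
  have h0 : ∀ U, ctlMat ∅ U x = U := fun U => by simp [ctlMat]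
  rw [h0, h0]
  unfold ctlMat
  split_ifs
  · rw [mul_assoc]
  · simp [hV]
/-! ### Counting gates and time slots -/

section count
variable {k : ℕ}

/-- The number of gates of the kind `f` in the time slots `S`. -/
def cst (f : Gate k → Bool) (S : List (List (Gate k))) : ℕ := S.flatten.countP f

/-- The number of time slots in `S` with a gate of the kind `f`. -/
def dpt (f : Gate k → Bool) (S : List (List (Gate k))) : ℕ := S.countP fun l => l.any f

variable (f : Gate k → Bool)

@[simp] theorem cst_nil : cst f [] = 0 := rfl
@[simp] theorem dpt_nil : dpt f [] = 0 := rfl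

@[simp] theorem cst_cons (l : List (Gate k)) (S : List (List (Gate k))) :
    cst f (l :: S) = l.countP f + cst f S := by simp [cst]

@[simp] theorem dpt_cons (l : List (Gate k)) (S : List (List (Gate k))) :
    dpt f (l :: S) = (if l.any f then 1 else 0) + dpt f S := by
  simp only [dpt, List.countP_cons, add_comm]

@[simp] theorem cst_append (S S' : List (List (Gate k))) :
    cst f (S ++ S') = cst f S + cst f S' := by simp [cst]

@[simp] theorem dpt_append (S S' : List (List (Gate k))) :
    dpt f (S ++ S') = dpt f S + dpt f S' := by simp [dpt]

variable {f}

theorem countP_invL (hf : ∀ g : Gate k, f g.inv = f g) (l : List (Gate k)) :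
    (invL l).countP f = l.countP f := by
  simp [invL, List.countP_reverse, List.countP_map, Function.comp_def, hf]

theorem any_invL (hf : ∀ g : Gate k, f g.inv = f g) (l : List (Gate k)) :
    (invL l).any f = l.any f := by
  simp [invL, List.any_map, Function.comp_def, hf]

theorem cst_invS (hf : ∀ g : Gate k, f g.inv = f g) (S : List (List (Gate k))) :
    cst f (Line.invS S) = cst f S := by
  rw [cst, Line.flatten_invS, countP_invL hf, cst]

theorem dpt_invS (hf : ∀ g : Gate k, f g.inv = f g) (S : List (List (Gate k))) :
    dpt f (Line.invS S) = dpt f S := by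
  simp [dpt, Line.invS, List.countP_reverse, List.countP_map, Function.comp_def, any_invL hf]

theorem cst_singles (l : List (Gate k)) : cst f (Line.singles l) = l.countP f := by
  rw [cst, Line.flatten_singles]

theorem dpt_singles (l : List (Gate k)) : dpt f (Line.singles l) = l.countP f := by
  simp [dpt, Line.singles, List.countP_map, Function.comp_def]

end count

namespace Line

variable {k : ℕ} (L : Line k)

theorem countP_cross_isCNOT (p e : ℕ) : (L.cross p e).countP Gate.isCNOT = e - p := by
  simp [cross, List.countP_map, Function.comp_def]

theorem countP_cross_of {f : Gate k → Bool} (hf : ∀ i j, f (L.cx i j) = false) (p e : ℕ) :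
    (L.cross p e).countP f = 0 := by
  simp [cross, List.countP_map, Function.comp_def, hf]

theorem count_serial {l : ℕ} : ∀ (E : List (Gate k)) (p : ℕ) (qs : List ℕ), Spaced l p qs →
    qs ≠ [] ∨ E = [] → (∀ g ∈ E, ∃ q, g = .h q) →
    cst Gate.isCNOT (L.serial l E p qs) + p + 1 = l + qs.length ∧
    dpt Gate.isCNOT (L.serial l E p qs) + p + 1 = l + qs.length ∧
    cst Gate.isT (L.serial l E p qs) = 2 * qs.length ∧
    dpt Gate.isT (L.serial l E p qs) = qs.length ∧
    cst Gate.isH (L.serial l E p qs) = qs.length + E.length ∧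
    dpt Gate.isH (L.serial l E p qs) = qs.length ∧
    cst Gate.isRotation (L.serial l E p qs) = 0
  | E, p, [], h, hE, _ => by
    have : p + 1 ≤ l := h
    obtain rfl : E = [] := by simpa using hE
    simp only [serial, cst_singles, dpt_singles, countP_cross_isCNOT,
      countP_cross_of L L.isT_cx, countP_cross_of L L.isH_cx, countP_cross_of L L.isRotation_cx]
    simp
    omega
  | E, p, q :: qs, h, _, hE => by
    have h1 := h.1
    have h2 := h.2.lt
    obtain ⟨i1, i2, i3, i4, i5, i6, i7⟩ :=
      count_serial [] (q + 1) qs h.2 (Or.inr rfl) (by simp)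
    have e1 : E.countP Gate.isCNOT = 0 := by
      rw [List.countP_eq_zero]; intro g hg; obtain ⟨q, rfl⟩ := hE g hg; simp [Gate.isCNOT]
    have e2 : E.countP Gate.isT = 0 := by
      rw [List.countP_eq_zero]; intro g hg; obtain ⟨q, rfl⟩ := hE g hg; simp [Gate.isT]
    have e3 : E.countP Gate.isRotation = 0 := by
      rw [List.countP_eq_zero]; intro g hg; obtain ⟨q, rfl⟩ := hE g hg; simp [Gate.isRotation]
    have e4 : E.countP Gate.isH = E.length := by
      rw [List.countP_eq_length]; intro g hg; obtain ⟨q, rfl⟩ := hE g hg; rfl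
    have e5 : E.any Gate.isCNOT = false := by
      rw [List.any_eq_false]; intro g hg; obtain ⟨q, rfl⟩ := hE g hg; simp [Gate.isCNOT]
    have e6 : E.any Gate.isT = false := by
      rw [List.any_eq_false]; intro g hg; obtain ⟨q, rfl⟩ := hE g hg; simp [Gate.isT]
    simp only [serial, cst_append, dpt_append, cst_singles, dpt_singles, countP_cross_isCNOT,
      countP_cross_of L L.isT_cx, countP_cross_of L L.isH_cx, countP_cross_of L L.isRotation_cx,
      cst_cons, dpt_cons, cst_nil, dpt_nil, i3, i4, i5, i6, i7, List.countP_cons, e1, e2, e3, e4,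
      List.countP_nil, List.any_cons, List.any_nil, e5, e6, isCNOT_cx, isT_cx, isH_cx,
      isRotation_cx, List.length_cons, List.length_nil]
    simp [Gate.isCNOT, Gate.isT, Gate.isH, Gate.isRotation]
    omega

theorem countP_wave_T (qs : List ℕ) :
    (qs.flatMap fun q => [.t (L.pos (q + 1)), .tdg (L.pos q)]).countP Gate.isT =
      2 * qs.length := by
  induction qs with
  | nil => rfl
  | cons q qs ih =>
    rw [List.flatMap_cons, List.countP_append, ih]
    simp [Gate.isT, List.countP_cons]
    omega

theorem countP_wave_of {f : Gate k → Bool} (h1 : ∀ q, f (.t q) = false)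
    (h2 : ∀ q, f (.tdg q) = false) (qs : List ℕ) :
    (qs.flatMap fun q => [.t (L.pos (q + 1)), .tdg (L.pos q)]).countP f = 0 := by
  rw [List.countP_eq_zero]
  intro g hg
  obtain ⟨q, _, hg⟩ := List.mem_flatMap.1 hg
  simp only [List.mem_cons, List.not_mem_nil, or_false] at hg
  rcases hg with rfl | rfl <;> simp [h1, h2]

theorem any_eq_false_of_countP {f : Gate k → Bool} {l : List (Gate k)} (h : l.countP f = 0) :
    l.any f = false := by
  rw [List.any_eq_false]
  exact List.countP_eq_zero.1 h

theorem count_wave (qs : List ℕ) :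
    cst Gate.isCNOT (L.wave qs) = 2 * qs.length ∧ dpt Gate.isCNOT (L.wave qs) ≤ 2 ∧
    cst Gate.isT (L.wave qs) = 2 * qs.length ∧ dpt Gate.isT (L.wave qs) ≤ 1 ∧
    cst Gate.isH (L.wave qs) = 0 ∧ dpt Gate.isH (L.wave qs) = 0 ∧
    cst Gate.isRotation (L.wave qs) = 0 := by
  have t1 := L.countP_wave_T qs
  have t2 := L.countP_wave_of (f := Gate.isCNOT) (fun _ => rfl) (fun _ => rfl) qs
  have t3 := L.countP_wave_of (f := Gate.isH) (fun _ => rfl) (fun _ => rfl) qs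
  have t4 := L.countP_wave_of (f := Gate.isRotation) (fun _ => rfl) (fun _ => rfl) qs
  have a2 := any_eq_false_of_countP t2
  have a3 := any_eq_false_of_countP t3
  simp only [wave, cst_cons, dpt_cons, cst_nil, dpt_nil, t1, t2, t3, t4, a2, a3, List.countP_map,
    List.any_map, Function.comp_def, isCNOT_cx, isT_cx, isH_cx, isRotation_cx]
  simp
  refine ⟨by omega, ?_, ?_⟩ <;> split_ifs <;> omega

/-- The numbers of gates and time slots of the conjugated CNOT gate. -/
theorem count_core {l p : ℕ} {qs : List ℕ} {E : List (Gate k)} (h : Spaced l p qs)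
    (hqs : qs ≠ []) (hE : ∀ g ∈ E, ∃ q, g = .h q) :
    cst Gate.isCNOT (L.core l E p qs) + 2 * p + 1 = 2 * l + 6 * qs.length ∧
    dpt Gate.isCNOT (L.core l E p qs) + 2 * p ≤ 2 * l + 2 * qs.length + 3 ∧
    cst Gate.isT (L.core l E p qs) = 8 * qs.length ∧
    dpt Gate.isT (L.core l E p qs) ≤ 2 * qs.length + 2 ∧
    cst Gate.isH (L.core l E p qs) = 2 * qs.length + 2 * E.length ∧
    dpt Gate.isH (L.core l E p qs) = 2 * qs.length ∧
    cst Gate.isRotation (L.core l E p qs) = 0 := by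
  obtain ⟨i1, i2, i3, i4, i5, i6, i7⟩ := L.count_serial E p qs h (Or.inl hqs) hE
  obtain ⟨j1, j2, j3, j4, j5, j6, j7⟩ := L.count_wave qs
  simp only [core, half, cst_append, dpt_append, cst_invS Gate.isCNOT_inv, cst_invS Gate.isT_inv,
    cst_invS Gate.isH_inv, cst_invS Gate.isRotation_inv, dpt_invS Gate.isCNOT_inv,
    dpt_invS Gate.isT_inv, dpt_invS Gate.isH_inv, cst_cons, dpt_cons, cst_nil, dpt_nil,
    List.countP_cons, List.countP_nil, List.any_cons, List.any_nil, isCNOT_cx, isT_cx, isH_cx,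
    isRotation_cx]
  simp
  omega

theorem count_moveBody : ∀ j : ℕ, cst Gate.isCNOT (L.moveBody (j + 1)) = 2 * j ∧
    dpt Gate.isCNOT (L.moveBody (j + 1)) = j ∧
    ∀ f : Gate k → Bool, (∀ i j, f (L.cx i j) = false) →
      cst f (L.moveBody (j + 1)) = 0 ∧ dpt f (L.moveBody (j + 1)) = 0
  | 0 => by simp [moveBody]
  | j + 1 => by
    obtain ⟨h1, h2, h3⟩ := count_moveBody j
    refine ⟨?_, ?_, fun f hf => ?_⟩
    · simp [moveBody, h1]; omega
    · simp [moveBody, h2]; omega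
    · simp [moveBody, (h3 f hf).1, (h3 f hf).2, hf]

theorem count_moveSlots (a : ℕ) : cst Gate.isCNOT (L.moveSlots a) ≤ 2 * (a - 1) ∧
    dpt Gate.isCNOT (L.moveSlots a) ≤ a + 1 ∧
    ∀ f : Gate k → Bool, (∀ i j, f (L.cx i j) = false) →
      cst f (L.moveSlots a) = 0 ∧ dpt f (L.moveSlots a) = 0 := by
  match a with
  | 0 => simp [moveSlots]
  | 1 => simp [moveSlots]
  | 2 =>
    refine ⟨?_, ?_, fun f hf => ?_⟩ <;> simp [moveSlots]
    simp [hf]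
  | a + 3 =>
    obtain ⟨h1, h2, h3⟩ := L.count_moveBody a
    refine ⟨?_, ?_, fun f hf => ?_⟩
    · simp [moveSlots, h1]; omega
    · simp [moveSlots, h2]; omega
    · simp [moveSlots, (h3 f hf).1, (h3 f hf).2, hf]

/-! ### Time slots with disjoint gates on neighbors -/

/-- Each time slot in `S` holds gates that act on disjoint sets of qubits, and on neighbors. -/
def Good (S : List (List (Gate k))) : Prop :=
  ∀ l ∈ S, (l.Pairwise fun g g' => Disjoint g.qubits g'.qubits) ∧ ∀ g ∈ l, g.IsLNN

theorem Good.append {S S' : List (List (Gate k))} (h : Good S) (h' : Good S') :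
    Good (S ++ S') := fun l hl => by
  rcases List.mem_append.1 hl with hl | hl
  · exact h l hl
  · exact h' l hl

theorem good_nil : Good ([] : List (List (Gate k))) := fun l hl => by simp at hl

theorem Good.cons {l : List (Gate k)} {S : List (List (Gate k))}
    (h1 : l.Pairwise fun g g' => Disjoint g.qubits g'.qubits) (h2 : ∀ g ∈ l, g.IsLNN)
    (h : Good S) : Good (l :: S) := fun l' hl' => by
  rcases List.mem_cons.1 hl' with rfl | hl'
  · exact ⟨h1, h2⟩
  · exact h l' hl'

theorem Good.single_cons {g : Gate k} {S : List (List (Gate k))} (hg : g.IsLNN) (h : Good S) :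
    Good ([g] :: S) := h.cons (List.pairwise_singleton _ _) (by simpa using hg)

theorem good_singles {l : List (Gate k)} (h : ∀ g ∈ l, g.IsLNN) : Good (singles l) := by
  intro l' hl'
  obtain ⟨g, hg, rfl⟩ := List.mem_map.1 hl'
  exact ⟨List.pairwise_singleton _ _, by simpa using h g hg⟩

theorem pairwise_invL {l : List (Gate k)}
    (h : l.Pairwise fun g g' => Disjoint g.qubits g'.qubits) :
    (invL l).Pairwise fun g g' => Disjoint g.qubits g'.qubits := by
  rw [invL, List.pairwise_reverse, List.pairwise_map]
  refine h.imp fun {g g'} hg => ?_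
  rw [Gate.qubits_inv, Gate.qubits_inv]
  exact hg.symm

theorem isLNN_invL {l : List (Gate k)} (h : ∀ g ∈ l, g.IsLNN) : ∀ g ∈ invL l, g.IsLNN := by
  intro g hg
  simp only [invL, List.mem_reverse, List.mem_map] at hg
  obtain ⟨g', hg', rfl⟩ := hg
  exact (Gate.isLNN_inv g').2 (h g' hg')

theorem Good.invS {S : List (List (Gate k))} (h : Good S) : Good (invS S) := by
  intro l hl
  simp only [Line.invS, List.mem_reverse, List.mem_map] at hl
  obtain ⟨l', hl', rfl⟩ := hl
  exact ⟨pairwise_invL (h l' hl').1, isLNN_invL (h l' hl').2⟩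

theorem Spaced.pairwise {l : ℕ} : ∀ {p : ℕ} {qs : List ℕ}, Spaced l p qs →
    qs.Pairwise fun q q' => q + 2 ≤ q'
  | _, [], _ => List.Pairwise.nil
  | _, _ :: _, h => List.Pairwise.cons (fun q' hq' => by have := h.2.mem q' hq'; omega) h.2.pairwise

theorem pairwise_map_of_spaced {l p : ℕ} {qs : List ℕ} (h : Spaced l p qs) {f : ℕ → Gate k}
    (hf : ∀ q ∈ qs, L.On (fun i => q ≤ i ∧ i ≤ q + 1) (f q)) :
    (qs.map f).Pairwise fun g g' => Disjoint g.qubits g'.qubits := by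
  rw [List.pairwise_map]
  refine h.pairwise.imp_of_mem fun {q q'} hq hq' hlt => ?_
  exact (hf q hq).disjoint (hf q' hq') fun i hi => by omega

theorem good_cross {p e : ℕ} (he : e < k) : ∀ g ∈ L.cross p e, g.IsLNN := by
  intro g hg
  simp only [cross, List.mem_map, List.mem_range'_1] at hg
  obtain ⟨i, hi, rfl⟩ := hg
  exact L.isLNN_cx (by omega) (by omega) (by omega)

theorem good_serial {l : ℕ} (hl : l < k) : ∀ (E : List (Gate k)) (p : ℕ) (qs : List ℕ),
    Spaced l p qs → (E = [] ∨ E = [.h (L.pos l)]) → Good (L.serial l E p qs)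
  | E, p, [], h, hE => by
    have : p + 1 ≤ l := h
    rw [serial]
    exact good_singles (L.good_cross (by omega))
  | E, p, q :: qs, h, hE => by
    have h1 := h.1
    have h2 := h.2.lt
    rw [serial]
    refine ((good_singles (L.good_cross (by omega))).append ?_).append
      (good_serial hl [] (q + 1) qs h.2 (Or.inl rfl))
    refine Good.single_cons (L.isLNN_cx (by omega) (by omega) (by omega)) <|
      Good.single_cons (L.isLNN_cx (by omega) (by omega) (by omega)) <|
      Good.cons ?_ ?_ <|
      Good.single_cons (L.isLNN_cx (by omega) (by omega) (by omega)) <|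
      Good.cons ?_ ?_ good_nil
    · simpa [Gate.qubits] using L.pos_ne (i := q) (j := q + 1) (by omega) (by omega) (by omega)
    · simp [Gate.IsLNN]
    · rcases hE with rfl | rfl
      · simp
      · simpa [Gate.qubits] using L.pos_ne (i := q + 1) (j := l) (by omega) (by omega) (by omega)
    · rcases hE with rfl | rfl <;> simp [Gate.IsLNN]

theorem pairwise_hads {l p : ℕ} {qs : List ℕ} (hl : l < k) (h : Spaced l p qs) :
    (L.hads qs).Pairwise fun g g' => Disjoint g.qubits g'.qubits :=
  L.pairwise_map_of_spaced h fun q hq => by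
    have := h.mem q hq
    exact L.on_of_qubits (i := q + 1) (by omega) (by omega) rfl

theorem isLNN_hads (qs : List ℕ) : ∀ g ∈ L.hads qs, g.IsLNN := by
  intro g hg
  obtain ⟨q, _, rfl⟩ := List.mem_map.1 hg
  trivial

theorem good_wave {l p : ℕ} {qs : List ℕ} (hl : l < k) (h : Spaced l p qs) :
    Good (L.wave qs) := by
  have hm := h.mem
  refine Good.cons ?_ ?_ <| Good.cons ?_ ?_ <| Good.cons ?_ ?_ good_nil
  · exact L.pairwise_map_of_spaced h fun q hq => by
      have := hm q hq
      exact L.on_cx (by omega) (by omega) (by omega) (by omega) (by omega)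
  · intro g hg
    obtain ⟨q, hq, rfl⟩ := List.mem_map.1 hg
    have := hm q hq
    exact L.isLNN_cx (by omega) (by omega) (by omega)
  · rw [List.pairwise_flatMap]
    refine ⟨fun q hq => ?_, h.pairwise.imp_of_mem fun {q q'} hq hq' hlt => ?_⟩
    · have := hm q hq
      simpa [Gate.qubits] using L.pos_ne (i := q + 1) (j := q) (by omega) (by omega) (by omega)
    · have := hm q hq
      have := hm q' hq'
      have n1 := L.pos_ne (i := q + 1) (j := q' + 1) (by omega) (by omega) (by omega)
      have n2 := L.pos_ne (i := q + 1) (j := q') (by omega) (by omega) (by omega)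
      have n3 := L.pos_ne (i := q) (j := q' + 1) (by omega) (by omega) (by omega)
      have n4 := L.pos_ne (i := q) (j := q') (by omega) (by omega) (by omega)
      simp [Gate.qubits, n1.symm, n2.symm, n3.symm, n4.symm]
  · intro g hg
    obtain ⟨q, _, hg⟩ := List.mem_flatMap.1 hg
    simp only [List.mem_cons, List.not_mem_nil, or_false] at hg
    rcases hg with rfl | rfl <;> trivial
  · exact L.pairwise_map_of_spaced h fun q hq => by
      have := hm q hq
      exact L.on_cx (by omega) (by omega) (by omega) (by omega) (by omega)
  · intro g hg
    obtain ⟨q, hq, rfl⟩ := List.mem_map.1 hg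
    have := hm q hq
    exact L.isLNN_cx (by omega) (by omega) (by omega)

theorem good_core {l p : ℕ} {qs : List ℕ} {E : List (Gate k)} (hl : l < k) (h : Spaced l p qs)
    (hE : E = [] ∨ E = [.h (L.pos l)]) : Good (L.core l E p qs) := by
  have := h.lt
  have hh := (L.good_wave hl h).append (L.good_serial hl E p qs h hE)
  exact (hh.append (Good.single_cons (L.isLNN_cx (by omega) hl (by omega)) good_nil)).append hh.invS

theorem good_moveBody : ∀ {j : ℕ}, j + 2 < k → Good (L.moveBody j)
  | 0, _ => good_nil
  | 1, _ => good_nil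
  | j + 2, hj => by
    refine Good.cons ?_ ?_ (good_moveBody (by omega))
    · rw [List.pairwise_pair]
      exact (L.on_cx (P := fun i => i ≤ j + 2) (by omega) (by omega) (by omega) (by omega)
        (by omega)).disjoint (L.on_cx (P := fun i => j + 3 ≤ i) (by omega) (by omega)
        (by omega) (by omega) (by omega)) fun i hi => by omega
    · simp only [List.mem_cons, List.not_mem_nil, or_false, forall_eq_or_imp, forall_eq]
      exact ⟨L.isLNN_cx (by omega) (by omega) (by omega),
        L.isLNN_cx (by omega) (by omega) (by omega)⟩

theorem good_moveSlots {a : ℕ} (ha : a < k) : Good (L.moveSlots a) := by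
  match a, ha with
  | 0, _ => exact good_nil
  | 1, _ => exact good_nil
  | 2, ha =>
    exact Good.single_cons (L.isLNN_cx (by omega) (by omega) (by omega)) <|
      Good.single_cons (L.isLNN_cx (by omega) (by omega) (by omega)) good_nil
  | a + 3, ha =>
    exact Good.single_cons (L.isLNN_cx (by omega) (by omega) (by omega)) <|
      Good.single_cons (L.isLNN_cx (by omega) (by omega) (by omega)) <|
      (L.good_moveBody (by omega)).append <|
      Good.single_cons (L.isLNN_cx (by omega) (by omega) (by omega)) <|
      Good.single_cons (L.isLNN_cx (by omega) (by omega) (by omega)) good_nil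

end Line

namespace Line

variable {k : ℕ} (L : Line k)

/-! ### The controlled rotation as a sequence of time slots -/

/-- The time slots of the commutator. The Hadamard gates at the end of a conjugated CNOT gate
share their time slot with those at the beginning of the next one, and with the rotation in
between. The Hadamard gates on the last control, at index `l₁`, are executed at the very beginning
and at the very end only. -/
noncomputable def wordSlots (τ : ℕ) (α : ℝ) (l₁ p₁ : ℕ) (qs₁ : List ℕ) (l₂ p₂ : ℕ)
    (qs₂ : List ℕ) : List (List (Gate k)) :=
  [.h (L.pos l₁) :: L.hads qs₁] ++ L.core l₁ [] p₁ qs₁ ++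
  [invL (L.hads qs₁) ++ .rx α (L.pos τ) :: L.hads qs₂] ++
  L.core l₂ [.h (L.pos l₂)] p₂ qs₂ ++
  [invL (L.hads qs₂) ++ .rx (-α) (L.pos τ) :: L.hads qs₁] ++ L.core l₁ [] p₁ qs₁ ++
  [invL (L.hads qs₁) ++ .rx α (L.pos τ) :: L.hads qs₂] ++
  L.core l₂ [.h (L.pos l₂)] p₂ qs₂ ++
  [invL (L.hads qs₂) ++ [.rx (-α) (L.pos τ), .h (L.pos l₁)]]

theorem wordSlots_flatten (τ : ℕ) (α : ℝ) (l₁ p₁ : ℕ) (qs₁ : List ℕ) (l₂ p₂ : ℕ)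
    (qs₂ : List ℕ) : (L.wordSlots τ α l₁ p₁ qs₁ l₂ p₂ qs₂).flatten =
      [.h (L.pos l₁)] ++ L.signList l₁ [] p₁ qs₁ ++ ([.rx α (L.pos τ)] ++
        L.signList l₂ [.h (L.pos l₂)] p₂ qs₂ ++ [.rx (-α) (L.pos τ)]) ++
      (L.signList l₁ [] p₁ qs₁ ++ ([.rx α (L.pos τ)] ++
        L.signList l₂ [.h (L.pos l₂)] p₂ qs₂ ++ [.rx (-α) (L.pos τ)])) ++ [.h (L.pos l₁)] := by
  simp [wordSlots, signList]

theorem on_hads {l p : ℕ} {qs : List ℕ} (hl : l < k) (h : Spaced l p qs) :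
    ∀ g ∈ L.hads qs, L.On (fun i => ∃ q ∈ qs, i = q + 1) g := by
  intro g hg
  obtain ⟨q, hq, rfl⟩ := List.mem_map.1 hg
  have := h.mem q hq
  exact L.on_of_qubits (i := q + 1) (by omega) ⟨q, hq, rfl⟩ rfl

theorem on_signList {l p : ℕ} {qs : List ℕ} (hl : l < k) (hqs : qs ≠ []) (h : Spaced l p qs) :
    ∀ g ∈ L.signList l [.h (L.pos l)] p qs, L.On (fun i => i ≤ l) g := by
  have hlt := h.lt
  have h1 : ∀ g ∈ L.hads qs ++ (L.half l [.h (L.pos l)] p qs).flatten, L.On (fun i => i ≤ l) g := by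
    intro g hg
    rw [half, List.flatten_append, ← List.append_assoc, List.mem_append, mem_hads_wave] at hg
    rcases hg with hg | hg
    · exact (L.on_flatMap_pre hl h g hg).mono fun i hi => by omega
    · cases qs with
      | nil => exact absurd rfl hqs
      | cons q qs =>
        have h1 := h.1
        have h2 := h.2.lt
        rw [serial_cons_flatten, List.mem_append, List.mem_append, List.mem_append] at hg
        rcases hg with ((hg | hg) | hg) | hg
        · exact (L.on_cross (by omega) g hg).mono fun i hi => by omega
        · exact (L.on_post (by omega) (by omega) g hg).mono fun i hi => by omega
        · obtain rfl := List.mem_singleton.1 hg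
          exact L.on_of_qubits (P := fun i => i ≤ l) (g := .h (L.pos l)) hl le_rfl rfl
        · exact (L.on_serial hl (q + 1) qs h.2 g hg).mono fun i hi => by omega
  intro g hg
  rw [signList_eq, List.mem_append, List.mem_append] at hg
  rcases hg with (hg | hg) | hg
  · exact h1 g hg
  · rw [List.mem_singleton] at hg
    rw [hg]
    exact L.on_cx (by omega) hl (by omega) (by omega) le_rfl
  · exact L.invL_on h1 g hg

variable {L}

theorem IsClass.mem {τ l p : ℕ} {qs : List ℕ} {K : Finset ℕ} (h : IsClass k τ l p qs K) :
    ∀ i ∈ K, i < k ∧ i ≠ τ := by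
  have hl := h.lt
  have hlt := h.spaced.lt
  have hm := h.spaced.mem
  intro i hi
  rcases h.cases with ⟨rfl, rfl⟩ | ⟨rfl, rest, rfl, rfl⟩
  · simp only [List.toFinset_cons, Finset.mem_insert, List.mem_toFinset] at hi
    rcases hi with rfl | hi
    · omega
    · have := hm i hi; omega
  · have hp := hm (p + 1) (by simp)
    simp only [List.toFinset_cons, Finset.mem_insert, List.mem_toFinset] at hi
    rcases hi with rfl | rfl | hi
    · omega
    · omega
    · have := h.spaced.2.mem i hi; omega

theorem IsClass.le_start {τ l p : ℕ} {qs : List ℕ} {K : Finset ℕ} (h : IsClass k τ l p qs K) :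
    τ ≤ p + 1 ∧ τ < l := by
  have hlt := h.spaced.lt
  have hm := h.spaced.mem
  rcases h.cases with ⟨rfl, rfl⟩ | ⟨rfl, rest, rfl, rfl⟩
  · omega
  · have hp := hm (p + 1) (by simp)
    omega

/-- The Hadamard gates on the qubit at `l₁` that are left out inside the commutator cancel in pairs,
since they commute with everything between the two occurrences of the first sign operator. -/
theorem ev_wordSlots {τ l₁ p₁ l₂ p₂ : ℕ} {qs₁ qs₂ : List ℕ} {K₁ K₂ : Finset ℕ}
    (h₁ : IsClass k τ l₁ p₁ qs₁ K₁) (h₂ : IsClass k τ l₂ p₂ qs₂ K₂) (hl : l₂ < l₁) (α : ℝ) :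
    ev (L.wordSlots τ α l₁ p₁ qs₁ l₂ p₂ qs₂).flatten =
      controlled ((K₁ ∪ K₂).image L.pos) (L.pos τ) (matRx (-4 * α)) := by
  obtain ⟨d₁, -, hA₁, hs₁, hd₁⟩ := h₁.exists_diag (L := L)
  obtain ⟨d₂, hA₂, -, hs₂, hd₂⟩ := h₂.exists_diag (L := L)
  have hτ := h₁.le_start
  have hl₁ := h₁.lt
  have hl₂ := h₂.lt
  have mem : ∀ {l p : ℕ} {qs : List ℕ} {K : Finset ℕ}, IsClass k τ l p qs K →
      L.pos τ ∉ K.image L.pos := by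
    intro l p qs K h hmem
    obtain ⟨i, hi, e⟩ := Finset.mem_image.1 hmem
    have := h.mem i hi
    exact L.pos_ne (i := i) (j := τ) this.1 (by omega) this.2 e
  have key := commutator_eq_controlled hA₁ hA₂ (mem h₁) (mem h₂)
    (fun x => by rw [hd₁]; simp only [Finset.forall_mem_image])
    (fun x => by rw [hd₂]; simp only [Finset.forall_mem_image]) hs₁ hs₂ α
  have c : Commute (ev [.h (L.pos l₁)]) (ev ([.rx α (L.pos τ)] ++
      L.signList l₂ [.h (L.pos l₂)] p₂ qs₂ ++ [.rx (-α) (L.pos τ)])) := by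
    refine L.commute_ev (P := fun i => i = l₁) (Q := fun i => i < l₁) ?_ ?_ fun i hi => by omega
    · intro g hg
      obtain rfl := List.mem_singleton.1 hg
      exact L.on_of_qubits (P := fun i => i = l₁) (g := .h (L.pos l₁)) hl₁ rfl rfl
    · intro g hg
      rw [List.mem_append, List.mem_append, List.mem_singleton, List.mem_singleton] at hg
      rcases hg with (rfl | hg) | rfl
      · exact L.on_of_qubits (i := τ) (by omega) (by omega) rfl
      · exact (L.on_signList hl₂ h₂.ne h₂.spaced g hg).mono fun i hi => by omega
      · exact L.on_of_qubits (i := τ) (by omega) (by omega) rfl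
  have hh : ev [.h (L.pos l₁)] * ev [.h (L.pos l₁)] = 1 := by
    rw [ev_singleton]; exact h_mul_self _
  rw [Finset.image_union, ← key, wordSlots_flatten]
  have hQ : (Gate.rx (-α) (L.pos τ)).toOp * ev (L.signList l₂ [.h (L.pos l₂)] p₂ qs₂) *
      (Gate.rx α (L.pos τ)).toOp = ev ([.rx α (L.pos τ)] ++
      L.signList l₂ [.h (L.pos l₂)] p₂ qs₂ ++ [.rx (-α) (L.pos τ)]) := by
    simp only [ev_append, ev_singleton, mul_assoc]
  rw [hQ]
  generalize [.rx α (L.pos τ)] ++ L.signList l₂ [.h (L.pos l₂)] p₂ qs₂ ++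
    [.rx (-α) (L.pos τ)] = Q at c ⊢
  simp only [ev_append]
  generalize ev [.h (L.pos l₁)] = H at c hh ⊢
  generalize ev (L.signList l₁ [] p₁ qs₁) = M
  generalize ev Q = Q at c ⊢
  calc H * (Q * M * (Q * (M * H))) = H * Q * M * (Q * (M * H)) := by simp only [mul_assoc]
    _ = Q * H * M * (Q * (M * H)) := by rw [c.eq]
    _ = Q * H * M * (1 * Q * (M * H)) := by rw [one_mul]
    _ = Q * H * M * (H * (H * Q) * (M * H)) := by rw [← hh]; simp only [mul_assoc]
    _ = Q * (H * (M * H)) * (Q * (H * (M * H))) := by rw [c.eq]; simp only [mul_assoc]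

theorem count_hads (qs : List ℕ) : (L.hads qs).countP Gate.isCNOT = 0 ∧
    (L.hads qs).countP Gate.isT = 0 ∧ (L.hads qs).countP Gate.isRotation = 0 ∧
    (L.hads qs).countP Gate.isH = qs.length := by
  simp [hads, List.countP_map, Function.comp_def, Gate.isCNOT, Gate.isT, Gate.isRotation,
    Gate.isH]

theorem count_wordSlots {τ l₁ p₁ l₂ p₂ : ℕ} {qs₁ qs₂ : List ℕ} {K₁ K₂ : Finset ℕ}
    (h₁ : IsClass k τ l₁ p₁ qs₁ K₁) (h₂ : IsClass k τ l₂ p₂ qs₂ K₂) (α : ℝ) :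
    cst Gate.isCNOT (L.wordSlots τ α l₁ p₁ qs₁ l₂ p₂ qs₂) + 4 * (p₁ + p₂) + 4 =
      4 * (l₁ + l₂) + 12 * (qs₁.length + qs₂.length) ∧
    dpt Gate.isCNOT (L.wordSlots τ α l₁ p₁ qs₁ l₂ p₂ qs₂) + 4 * (p₁ + p₂) ≤
      4 * (l₁ + l₂) + 4 * (qs₁.length + qs₂.length) + 12 ∧
    cst Gate.isT (L.wordSlots τ α l₁ p₁ qs₁ l₂ p₂ qs₂) = 16 * (qs₁.length + qs₂.length) ∧
    dpt Gate.isT (L.wordSlots τ α l₁ p₁ qs₁ l₂ p₂ qs₂) ≤ 4 * (qs₁.length + qs₂.length) + 8 ∧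
    cst Gate.isH (L.wordSlots τ α l₁ p₁ qs₁ l₂ p₂ qs₂) = 8 * (qs₁.length + qs₂.length) + 6 ∧
    dpt Gate.isH (L.wordSlots τ α l₁ p₁ qs₁ l₂ p₂ qs₂) ≤ 4 * (qs₁.length + qs₂.length) + 5 ∧
    cst Gate.isRotation (L.wordSlots τ α l₁ p₁ qs₁ l₂ p₂ qs₂) = 4 := by
  obtain ⟨i1, i2, i3, i4, i5, i6, i7⟩ :=
    L.count_core (E := []) h₁.spaced h₁.ne (by simp)
  obtain ⟨j1, j2, j3, j4, j5, j6, j7⟩ :=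
    L.count_core (E := [.h (L.pos l₂)]) h₂.spaced h₂.ne (by simp)
  obtain ⟨a1, a2, a3, a4⟩ := L.count_hads qs₁
  obtain ⟨b1, b2, b3, b4⟩ := L.count_hads qs₂
  have le1 : ∀ b : Bool, (if b = true then 1 else 0) ≤ 1 := by decide
  simp only [List.length_nil, List.length_singleton] at i5 j5
  refine ⟨?_, ?_, ?_, ?_, ?_, ?_, ?_⟩
  · simp only [wordSlots, cst_append, cst_cons, cst_nil, List.countP_append, List.countP_cons,
      List.countP_nil, countP_invL Gate.isCNOT_inv, a1, b1]
    simp [Gate.isCNOT]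
    omega
  · simp only [wordSlots, dpt_append, dpt_cons, dpt_nil, List.any_append, List.any_cons,
      List.any_nil, any_invL Gate.isCNOT_inv, any_eq_false_of_countP a1, any_eq_false_of_countP b1]
    simp [Gate.isCNOT]
    omega
  · simp only [wordSlots, cst_append, cst_cons, cst_nil, List.countP_append, List.countP_cons,
      List.countP_nil, countP_invL Gate.isT_inv, a2, b2]
    simp [Gate.isT]
    omega
  · simp only [wordSlots, dpt_append, dpt_cons, dpt_nil, List.any_append, List.any_cons,
      List.any_nil, any_invL Gate.isT_inv, any_eq_false_of_countP a2, any_eq_false_of_countP b2]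
    simp [Gate.isT]
    omega
  · simp only [wordSlots, cst_append, cst_cons, cst_nil, List.countP_append, List.countP_cons,
      List.countP_nil, countP_invL Gate.isH_inv, a4, b4]
    simp [Gate.isH]
    omega
  · simp only [wordSlots, dpt_append, dpt_cons, dpt_nil, i6, j6]
    have e1 := le1 ((Gate.h (L.pos l₁) :: L.hads qs₁).any Gate.isH)
    have e2 := le1 ((invL (L.hads qs₁) ++ .rx α (L.pos τ) :: L.hads qs₂).any Gate.isH)
    have e3 := le1 ((invL (L.hads qs₂) ++ .rx (-α) (L.pos τ) :: L.hads qs₁).any Gate.isH)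
    have e4 := le1 ((invL (L.hads qs₂) ++
      [Gate.rx (-α) (L.pos τ), Gate.h (L.pos l₁)]).any Gate.isH)
    omega
  · simp only [wordSlots, cst_append, cst_cons, cst_nil, List.countP_append, List.countP_cons,
      List.countP_nil, countP_invL Gate.isRotation_inv, a3, b3]
    simp [Gate.isRotation]
    omega

theorem good_wordSlots {τ l₁ p₁ l₂ p₂ : ℕ} {qs₁ qs₂ : List ℕ} {K₁ K₂ : Finset ℕ}
    (h₁ : IsClass k τ l₁ p₁ qs₁ K₁) (h₂ : IsClass k τ l₂ p₂ qs₂ K₂) (hl : l₂ < l₁)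
    (hd : ∀ q ∈ qs₁, q ∉ qs₂) (α : ℝ) : Good (L.wordSlots τ α l₁ p₁ qs₁ l₂ p₂ qs₂) := by
  have hτ₁ := h₁.le_start
  have hτ₂ := h₂.le_start
  have hl₁ := h₁.lt
  have hl₂ := h₂.lt
  have hm₁ := h₁.spaced.mem
  have hm₂ := h₂.spaced.mem
  have oh₁ := L.on_hads hl₁ h₁.spaced
  have oh₂ := L.on_hads hl₂ h₂.spaced
  have oi₁ := L.invL_on oh₁
  have oi₂ := L.invL_on oh₂
  have ph₁ := L.pairwise_hads hl₁ h₁.spaced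
  have ph₂ := L.pairwise_hads hl₂ h₂.spaced
  have nh₁ := L.isLNN_hads qs₁
  have nh₂ := L.isLNN_hads qs₂
  have on_h : L.On (fun i => i = l₁) (.h (L.pos l₁)) := L.on_of_qubits (P := fun i => i = l₁) (g := .h (L.pos l₁)) hl₁ rfl rfl
  have on_rx : ∀ θ, L.On (fun i => i = τ) (.rx θ (L.pos τ)) :=
    fun θ => L.on_of_qubits (P := fun i => i = τ) (g := .rx θ (L.pos τ)) (by omega) rfl rfl
  have c₁ := L.good_core (E := []) hl₁ h₁.spaced (Or.inl rfl)
  have c₂ := L.good_core (E := [.h (L.pos l₂)]) hl₂ h₂.spaced (Or.inr rfl)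
  have nrx : ∀ θ, (Gate.rx θ (L.pos τ)).IsLNN := fun _ => trivial
  have nh : (Gate.h (L.pos l₁)).IsLNN := trivial
  have j12 : ∀ θ, Good [invL (L.hads qs₁) ++ .rx θ (L.pos τ) :: L.hads qs₂] := by
    intro θ
    refine Good.cons ?_ ?_ good_nil
    · rw [List.pairwise_append, List.pairwise_cons]
      refine ⟨pairwise_invL ph₁, ⟨fun g hg => (on_rx θ).disjoint (oh₂ g hg) ?_, ph₂⟩,
        fun g hg g' hg' => ?_⟩
      · rintro i rfl ⟨q, hq, e⟩
        have := hm₂ q hq; omega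
      · rcases List.mem_cons.1 hg' with rfl | hg'
        · refine (oi₁ g hg).disjoint (on_rx θ) ?_
          rintro i ⟨q, hq, e⟩ rfl
          have := hm₁ q hq; omega
        · refine (oi₁ g hg).disjoint (oh₂ g' hg') ?_
          rintro i ⟨q, hq, e⟩ ⟨q', hq', e'⟩
          obtain rfl : q = q' := by omega
          exact hd q hq hq'
    · intro g hg
      rw [List.mem_append, List.mem_cons] at hg
      rcases hg with hg | rfl | hg
      · exact isLNN_invL nh₁ g hg
      · exact nrx _
      · exact nh₂ g hg
  have j21 : Good [invL (L.hads qs₂) ++ .rx (-α) (L.pos τ) :: L.hads qs₁] := by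
    refine Good.cons ?_ ?_ good_nil
    · rw [List.pairwise_append, List.pairwise_cons]
      refine ⟨pairwise_invL ph₂, ⟨fun g hg => (on_rx _).disjoint (oh₁ g hg) ?_, ph₁⟩,
        fun g hg g' hg' => ?_⟩
      · rintro i rfl ⟨q, hq, e⟩
        have := hm₁ q hq; omega
      · rcases List.mem_cons.1 hg' with rfl | hg'
        · refine (oi₂ g hg).disjoint (on_rx _) ?_
          rintro i ⟨q, hq, e⟩ rfl
          have := hm₂ q hq; omega
        · refine (oi₂ g hg).disjoint (oh₁ g' hg') ?_
          rintro i ⟨q, hq, e⟩ ⟨q', hq', e'⟩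
          obtain rfl : q = q' := by omega
          exact hd q hq' hq
    · intro g hg
      rw [List.mem_append, List.mem_cons] at hg
      rcases hg with hg | rfl | hg
      · exact isLNN_invL nh₂ g hg
      · exact nrx _
      · exact nh₁ g hg
  have j1 : Good [.h (L.pos l₁) :: L.hads qs₁] := by
    refine Good.cons ?_ ?_ good_nil
    · rw [List.pairwise_cons]
      refine ⟨fun g hg => on_h.disjoint (oh₁ g hg) ?_, ph₁⟩
      rintro i rfl ⟨q, hq, e⟩
      have := hm₁ q hq; omega
    · intro g hg
      rcases List.mem_cons.1 hg with rfl | hg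
      · exact nh
      · exact nh₁ g hg
  have j2 : Good [invL (L.hads qs₂) ++ [.rx (-α) (L.pos τ), .h (L.pos l₁)]] := by
    refine Good.cons ?_ ?_ good_nil
    · rw [List.pairwise_append, List.pairwise_pair]
      refine ⟨pairwise_invL ph₂, (on_rx _).disjoint on_h fun i hi => by omega,
        fun g hg g' hg' => ?_⟩
      simp only [List.mem_cons, List.not_mem_nil, or_false] at hg'
      rcases hg' with rfl | rfl
      · refine (oi₂ g hg).disjoint (on_rx _) ?_
        rintro i ⟨q, hq, e⟩ rfl
        have := hm₂ q hq; omega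
      · refine (oi₂ g hg).disjoint on_h ?_
        rintro i ⟨q, hq, e⟩ rfl
        have := hm₂ q hq; omega
    · intro g hg
      simp only [List.mem_append, List.mem_cons, List.not_mem_nil, or_false] at hg
      rcases hg with hg | rfl | rfl
      · exact isLNN_invL nh₂ g hg
      · exact nrx _
      · exact nh
  exact (((((((j1.append c₁).append (j12 α)).append c₂).append j21).append c₁).append
    (j12 α)).append c₂).append j2

end Line

namespace Line

/-! ### Splitting the controls into two classes -/

/-- The entries of a list at even positions, and those at odd positions. -/
def alternate : List ℕ → List ℕ × List ℕ
  | [] => ([], [])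
  | a :: l => (a :: (alternate l).2, (alternate l).1)

/-- An increasing list of numbers above `p` without consecutive numbers. -/
def Gap : ℕ → List ℕ → Prop
  | _, [] => True
  | p, a :: l => p + 1 ≤ a ∧ Gap (a + 1) l

theorem Gap.mono {p p' : ℕ} (h : p' ≤ p) : ∀ {l : List ℕ}, Gap p l → Gap p' l
  | [], _ => trivial
  | _ :: _, hl => ⟨by have := hl.1; omega, hl.2⟩

theorem gap_alternate : ∀ {l : List ℕ} {p : ℕ}, l.Pairwise (· < ·) → (∀ x ∈ l, p < x) →
    Gap p (alternate l).1 ∧ Gap (p + 1) (alternate l).2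
  | [], _, _, _ => ⟨trivial, trivial⟩
  | a :: l, p, hl, hp => by
    obtain ⟨h1, h2⟩ := gap_alternate (List.pairwise_cons.1 hl).2 (List.pairwise_cons.1 hl).1
    have := hp a (by simp)
    exact ⟨⟨this, h2⟩, h1.mono this⟩

theorem alternate_perm : ∀ l : List ℕ, ((alternate l).1 ++ (alternate l).2).Perm l
  | [] => .nil
  | a :: l => by
    rw [alternate, List.cons_append]
    exact (List.perm_append_comm.trans (alternate_perm l)).cons a

theorem length_alternate : ∀ l : List ℕ, (alternate l).2.length ≤ (alternate l).1.length ∧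
    (alternate l).1.length ≤ (alternate l).2.length + 1
  | [] => by simp [alternate]
  | a :: l => by
    have := length_alternate l
    simp only [alternate, List.length_cons]
    omega

theorem Gap.spaced {l : ℕ} : ∀ {p : ℕ} {qs : List ℕ}, Gap p (qs ++ [l]) → Spaced l p qs
  | _, [], h => h.1
  | _, _ :: _, h => ⟨h.1, h.2.spaced⟩

/-- The controls other than a control at the end of the line are assigned to the two classes
alternately, so that the qubit next to a control is never a control of the same class. -/
theorem exists_classes_aux {k τ : ℕ} (D : Finset ℕ) (hτ : τ ≤ 1) (hD : 6 ≤ D.card)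
    (hk : ∀ i ∈ D, i < k) (hτD : τ ∉ D) :
    ∃ (l₁ p₁ : ℕ) (qs₁ : List ℕ) (l₂ p₂ : ℕ) (qs₂ : List ℕ) (K₁ K₂ : Finset ℕ),
      IsClass k τ l₁ p₁ qs₁ K₁ ∧ IsClass k τ l₂ p₂ qs₂ K₂ ∧ l₁ ≠ l₂ ∧ K₁ ∪ K₂ = D ∧
      (∀ q ∈ qs₁, q ∉ qs₂) ∧ qs₁.length + qs₂.length + 2 = D.card ∧ τ ≤ p₁ + p₂ := by
  obtain ⟨l, hl⟩ : ∃ l : List ℕ, l = (D.filter fun i => τ < i).sort (· ≤ ·) := ⟨_, rfl⟩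
  have hmem : ∀ x, x ∈ l ↔ x ∈ D ∧ τ < x := by simp [hl]
  have hsort : l.Pairwise (· < ·) := hl ▸ (Finset.sortedLT_sort _).pairwise
  have hlen : l.length = (D.filter fun i => τ < i).card := by rw [hl, Finset.length_sort]
  have hperm := alternate_perm l
  have hln := length_alternate l
  have hlp := hperm.length_eq
  have hnodup : ((alternate l).1 ++ (alternate l).2).Nodup :=
    hperm.nodup_iff.2 (hsort.imp fun h => ne_of_lt h)
  obtain ⟨g1, g2⟩ := gap_alternate hsort fun x hx => ((hmem x).1 hx).2
  have hmem' : ∀ x, (x ∈ (alternate l).1 ∨ x ∈ (alternate l).2) ↔ x ∈ D ∧ τ < x := by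
    intro x
    rw [← hmem, ← hperm.mem_iff, List.mem_append]
  rw [List.length_append] at hlp
  -- The only control that is not above `τ` is one at index `0`, in the case `τ = 1`.
  have hcard : D.card ≤ l.length + 1 ∧ (0 ∉ D ∨ τ = 0 → D.card = l.length) ∧
      (0 ∈ D → D.card = l.length + 1) := by
    rw [hlen]
    by_cases h0 : 0 ∈ D ∧ τ = 1
    · have : D = insert 0 (D.filter fun i => τ < i) := by
        ext x
        simp only [Finset.mem_insert, Finset.mem_filter]
        constructor
        · intro hx
          have : x ≠ τ := fun e => hτD (e ▸ hx)
          by_cases hx0 : x = 0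
          · exact Or.inl hx0
          · exact Or.inr ⟨hx, by omega⟩
        · rintro (rfl | ⟨hx, _⟩)
          · exact h0.1
          · exact hx
      have hc := congrArg Finset.card this
      rw [Finset.card_insert_of_notMem (by simp)] at hc
      refine ⟨by omega, fun h => ?_, fun _ => by omega⟩
      rcases h with h | h
      · exact absurd h0.1 h
      · omega
    · have : (D.filter fun i => τ < i) = D := by
        rw [Finset.filter_eq_self]
        intro x hx
        have h1 : x ≠ τ := fun e => hτD (e ▸ hx)
        have h2 : ¬ (x = 0 ∧ τ = 1) := fun e => h0 ⟨e.1 ▸ hx, e.2⟩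
        omega
      rw [this]
      refine ⟨by omega, fun _ => rfl, fun h => ?_⟩
      have : τ = 0 := by
        by_contra hne
        exact h0 ⟨h, by omega⟩
      exact absurd (this ▸ h) hτD
  generalize (alternate l).1 = A at *
  generalize (alternate l).2 = B at *
  have hA : A ≠ [] := by rintro rfl; simp only [List.length_nil] at hln hlp; omega
  have hB : B ≠ [] := by rintro rfl; simp only [List.length_nil] at hln hlp; omega
  obtain ⟨q₁, l₁, rfl⟩ : ∃ q l, A = q ++ [l] :=
    ⟨A.dropLast, A.getLast hA, (List.dropLast_append_getLast hA).symm⟩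
  obtain ⟨q₂, l₂, rfl⟩ : ∃ q l, B = q ++ [l] :=
    ⟨B.dropLast, B.getLast hB, (List.dropLast_append_getLast hB).symm⟩
  simp only [List.length_append, List.length_singleton] at hln hlp
  have hdis := (List.nodup_append.1 hnodup).2.2
  have hne : l₁ ≠ l₂ := hdis l₁ (by simp) l₂ (by simp)
  have hl₁ := (hmem' l₁).1 (by simp)
  have hl₂ := (hmem' l₂).1 (by simp)
  have c₁ : IsClass k τ l₁ τ q₁ (l₁ :: q₁).toFinset :=
    { lt := hk _ hl₁.1
      spaced := g1.spaced
      ne := by rintro rfl; simp only [List.length_nil] at hln hlp; omega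
      cases := Or.inl ⟨rfl, rfl⟩ }
  have hdq : ∀ q ∈ q₁, q ∉ q₂ := fun q hq hq' => hdis q (by simp [hq]) q (by simp [hq']) rfl
  by_cases h0 : 0 ∈ D
  · -- The first class starts at `τ = 1`, the second one at the control at the end of the line.
    have hτ1 : τ = 1 := by
      have : τ ≠ 0 := fun e => hτD (e ▸ h0)
      omega
    subst hτ1
    have := hcard.2.2 h0
    refine ⟨l₁, 1, q₁, l₂, 0, 1 :: q₂, _, (0 :: l₂ :: q₂).toFinset, c₁,
      { lt := hk _ hl₂.1
        spaced := ⟨le_rfl, g2.spaced⟩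
        ne := by simp
        cases := Or.inr ⟨rfl, q₂, rfl, rfl⟩ }, hne, ?_, ?_, ?_, ?_⟩
    · ext x
      have hx := hmem' x
      simp only [List.mem_append, List.mem_singleton] at hx
      simp only [List.toFinset_cons, Finset.mem_union, Finset.mem_insert, List.mem_toFinset]
      constructor
      · rintro ((h | h) | (h | h | h))
        · exact (hx.1 (Or.inl (Or.inr h))).1
        · exact (hx.1 (Or.inl (Or.inl h))).1
        · exact h ▸ h0
        · exact (hx.1 (Or.inr (Or.inr h))).1
        · exact (hx.1 (Or.inr (Or.inl h))).1
      · intro h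
        have h1 : x ≠ 1 := fun e => hτD (e ▸ h)
        by_cases hx0 : x = 0
        · exact Or.inr (Or.inl hx0)
        · rcases hx.2 ⟨h, by omega⟩ with (h | h) | (h | h)
          · exact Or.inl (Or.inr h)
          · exact Or.inl (Or.inl h)
          · exact Or.inr (Or.inr (Or.inr h))
          · exact Or.inr (Or.inr (Or.inl h))
    · intro q hq hq'
      have h1 := ((hmem' q).1 (by simp [hq])).2
      rcases List.mem_cons.1 hq' with rfl | hq'
      · omega
      · exact hdq q hq hq'
    · rw [List.length_cons]; omega
    · omega
  · have := hcard.2.1 (Or.inl h0)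
    refine ⟨l₁, τ, q₁, l₂, τ, q₂, _, (l₂ :: q₂).toFinset, c₁,
      { lt := hk _ hl₂.1
        spaced := (g2.mono (by omega)).spaced
        ne := by rintro rfl; simp only [List.length_nil] at hln hlp; omega
        cases := Or.inl ⟨rfl, rfl⟩ }, hne, ?_, hdq, by omega, by omega⟩
    ext x
    have hx := hmem' x
    simp only [List.mem_append, List.mem_singleton] at hx
    simp only [List.toFinset_cons, Finset.mem_union, Finset.mem_insert, List.mem_toFinset]
    constructor
    · rintro ((h | h) | (h | h))
      · exact (hx.1 (Or.inl (Or.inr h))).1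
      · exact (hx.1 (Or.inl (Or.inl h))).1
      · exact (hx.1 (Or.inr (Or.inr h))).1
      · exact (hx.1 (Or.inr (Or.inl h))).1
    · intro h
      have h1 : x ≠ τ := fun e => hτD (e ▸ h)
      have h2 : x ≠ 0 := fun e => h0 (e ▸ h)
      rcases hx.2 ⟨h, by omega⟩ with (h | h) | (h | h)
      · exact Or.inl (Or.inr h)
      · exact Or.inl (Or.inl h)
      · exact Or.inr (Or.inr h)
      · exact Or.inr (Or.inl h)

theorem exists_classes {k τ : ℕ} (D : Finset ℕ) (hτ : τ ≤ 1) (hD : 6 ≤ D.card)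
    (hk : ∀ i ∈ D, i < k) (hτD : τ ∉ D) :
    ∃ (l₁ p₁ : ℕ) (qs₁ : List ℕ) (l₂ p₂ : ℕ) (qs₂ : List ℕ) (K₁ K₂ : Finset ℕ),
      IsClass k τ l₁ p₁ qs₁ K₁ ∧ IsClass k τ l₂ p₂ qs₂ K₂ ∧ l₂ < l₁ ∧ K₁ ∪ K₂ = D ∧
      (∀ q ∈ qs₁, q ∉ qs₂) ∧ qs₁.length + qs₂.length + 2 = D.card ∧ τ ≤ p₁ + p₂ := by
  obtain ⟨l₁, p₁, qs₁, l₂, p₂, qs₂, K₁, K₂, h₁, h₂, hne, hK, hd, hlen, hp⟩ :=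
    exists_classes_aux D hτ hD hk hτD
  rcases lt_or_gt_of_ne hne with h | h
  · exact ⟨l₂, p₂, qs₂, l₁, p₁, qs₁, K₂, K₁, h₂, h₁, h, by rw [Finset.union_comm, hK],
      fun q hq hq' => hd q hq' hq, by omega, by omega⟩
  · exact ⟨l₁, p₁, qs₁, l₂, p₂, qs₂, K₁, K₂, h₁, h₂, h, hK, hd, hlen, hp⟩

/-! ### The circuit -/

/-- The numbering from the left end of the line. -/
def fwd (k : ℕ) (hk : 2 ≤ k) : Line k where
  pos i := ⟨min i (k - 1), by omega⟩
  inj i j hi hj h := by simp only [Fin.mk.injEq] at h; omega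
  adj i hi := by simp only; omega
  two h := by simp only [Fin.mk.injEq] at h; omega

/-- The numbering from the right end of the line. -/
def bwd (k : ℕ) (hk : 2 ≤ k) : Line k where
  pos i := ⟨k - 1 - i, by omega⟩
  inj i j hi hj h := by simp only [Fin.mk.injEq] at h; omega
  adj i hi := by simp only; omega
  two h := by simp only [Fin.mk.injEq] at h; omega

theorem exists_line {k : ℕ} (hk : 2 ≤ k) (t : Fin k) :
    ∃ (L : Line k) (a : ℕ), 2 * a + 1 ≤ k ∧ L.pos a = t := by
  have ht := t.isLt
  by_cases h : 2 * (t : ℕ) + 1 ≤ k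
  · exact ⟨fwd k hk, t, h, Fin.ext (by simp only [fwd]; omega)⟩
  · exact ⟨bwd k hk, k - 1 - t, by omega, Fin.ext (by simp only [bwd]; omega)⟩

variable {k : ℕ} (L : Line k)

theorem exists_pos_eq (v : Fin k) : ∃ i, i < k ∧ L.pos i = v := by
  have hinj : Injective fun i : Fin k => L.pos i :=
    fun i j h => Fin.ext (L.inj i j i.isLt j.isLt h)
  obtain ⟨i, hi⟩ := (Finite.injective_iff_surjective.1 hinj) v
  exact ⟨i, i.isLt, hi⟩

/-- A set of qubits as the image of a set of indices. -/
theorem exists_indices (C : Finset (Fin k)) : ∃ D : Finset ℕ, (∀ i ∈ D, i < k) ∧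
    D.image L.pos = C ∧ D.card = C.card ∧ ∀ i, L.pos i ∉ C → i ∉ D := by
  have himg : ((Finset.range k).filter (L.pos · ∈ C)).image L.pos = C := by
    ext v
    simp only [Finset.mem_image, Finset.mem_filter, Finset.mem_range]
    constructor
    · rintro ⟨i, hi, rfl⟩; exact hi.2
    · intro hv
      obtain ⟨i, hi, rfl⟩ := L.exists_pos_eq v
      exact ⟨i, ⟨hi, hv⟩, rfl⟩
  refine ⟨(Finset.range k).filter (L.pos · ∈ C), by simp +contextual, himg, ?_, ?_⟩
  · conv_rhs => rw [← himg]
    rw [Finset.card_image_of_injOn]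
    intro i hi j hj h
    simp only [Finset.coe_filter, Finset.mem_range, Set.mem_ofPred_eq] at hi hj
    exact L.inj i j hi.1 hj.1 h
  · intro i hi hmem
    exact hi (Finset.mem_filter.1 hmem).2

/-- The time slots for a controlled `R_x`: the target moves to index `1`, unless it is at the end
of the line. -/
theorem exists_slots {n a : ℕ} (hn : 6 ≤ n) (hk : n < k) (ha : 2 * a + 1 ≤ k) {C : Finset (Fin k)}
    (hC : C.card = n) (hat : L.pos a ∉ C) (φ : ℝ) :
    ∃ S : List (List (Gate k)), Good S ∧ ev S.flatten = controlled C (L.pos a) (matRx φ) ∧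
      cst Gate.isRotation S = 4 ∧
      cst Gate.isCNOT S ≤ 10 * k + 12 * n - 50 ∧ dpt Gate.isCNOT S ≤ 9 * k + 4 * n - 5 ∧
      cst Gate.isT S ≤ 16 * n - 32 ∧ dpt Gate.isT S ≤ 4 * n ∧
      cst Gate.isH S ≤ 8 * n - 10 ∧ dpt Gate.isH S ≤ 4 * n - 3 := by
  obtain ⟨C', hC', hτC', hmove⟩ : ∃ C' : Finset (Fin k), C'.card = C.card ∧
      L.pos (min a 1) ∉ C' ∧ ∀ W : List (Gate k),
      ev W = controlled C' (L.pos (min a 1)) (matRx φ) →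
      ev (L.move a ++ W ++ invL (L.move a)) = controlled C (L.pos a) (matRx φ) := by
    by_cases h0 : a = 0
    · subst h0
      exact ⟨C, rfl, hat, fun W hW => by simpa [move, invL] using hW⟩
    · obtain ⟨C', h1, h2, h3⟩ := L.exists_move_conj (a := a) (by omega) (by omega) hat
      rw [show min a 1 = 1 by omega]
      exact ⟨C', h1, h2, h3 φ⟩
  obtain ⟨D, hDk, hDC, hDc, hDτ⟩ := L.exists_indices C'
  obtain ⟨l₁, p₁, qs₁, l₂, p₂, qs₂, K₁, K₂, h₁, h₂, hl, hK, hd, hlen, hp⟩ :=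
    exists_classes (k := k) (τ := min a 1) D (by omega) (by omega) hDk (hDτ _ hτC')
  have hl₁ := h₁.lt
  -- The commutator with rotations by `∓ φ / 4` is the controlled rotation by `φ`.
  have hev := ev_wordSlots (L := L) h₁ h₂ hl (-φ / 4)
  rw [hK, hDC, show -4 * (-φ / 4) = φ by ring] at hev
  have hm := L.ev_moveSlots (a := a) (by omega)
  obtain ⟨m1, m2, m3⟩ := L.count_moveSlots a
  obtain ⟨w1, w2, w3, w4, w5, w6, w7⟩ := count_wordSlots (L := L) h₁ h₂ (-φ / 4)
  have hgood := L.good_moveSlots (a := a) (by omega)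
  refine ⟨L.moveSlots a ++ L.wordSlots (min a 1) (-φ / 4) l₁ p₁ qs₁ l₂ p₂ qs₂ ++
    invS (L.moveSlots a), (hgood.append (good_wordSlots h₁ h₂ hl hd _)).append hgood.invS,
    ?_, ?_, ?_, ?_, ?_, ?_, ?_, ?_⟩
  · rw [← hmove _ hev, List.flatten_append, List.flatten_append, flatten_invS]
    simp only [ev_append, hm, ev_invL_congr hm]
  · rw [cst_append, cst_append, cst_invS Gate.isRotation_inv, (m3 _ L.isRotation_cx).1, w7]
  · rw [cst_append, cst_append, cst_invS Gate.isCNOT_inv]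
    omega
  · rw [dpt_append, dpt_append, dpt_invS Gate.isCNOT_inv]
    omega
  · rw [cst_append, cst_append, cst_invS Gate.isT_inv, (m3 _ L.isT_cx).1, w3]
    omega
  · rw [dpt_append, dpt_append, dpt_invS Gate.isT_inv, (m3 _ L.isT_cx).2]
    omega
  · rw [cst_append, cst_append, cst_invS Gate.isH_inv, (m3 _ L.isH_cx).1, w5]
    omega
  · rw [dpt_append, dpt_append, dpt_invS Gate.isH_inv, (m3 _ L.isH_cx).2]
    omega

end Line

end LNN

theorem mainTheorem4 (n k : ℕ) (hn : 6 ≤ n) (hk : n < k)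
    (C : Finset (Fin k)) (hC : C.card = n) (t : Fin k) (ht : t ∉ C)
    (W : Matrix (Fin 2) (Fin 2) ℂ) (hW : W ∈ Matrix.specialUnitaryGroup (Fin 2) ℂ) :
    ∃ c : LNN.Circuit k,
      c.IsLNN ∧
      c.toOp = LNN.controlled C t W ∧
      c.cost LNN.Gate.isRotation = 8 ∧
      c.cost LNN.Gate.isCNOT ≤ 10 * k + 12 * n - 50 ∧
      c.depth LNN.Gate.isCNOT ≤ 9 * k + 4 * n - 5 ∧
      c.cost LNN.Gate.isT ≤ 16 * n - 32 ∧
      c.depth LNN.Gate.isT ≤ 4 * n ∧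
      c.cost LNN.Gate.isH ≤ 8 * n - 10 ∧
      c.depth LNN.Gate.isH ≤ 4 * n - 3 := by
  open LNN LNN.Line in
  obtain ⟨β, γ, φ, rfl⟩ := exists_eq_conj_matRx hW
  obtain ⟨L, a, ha, rfl⟩ := exists_line (by omega) t
  obtain ⟨S, hS, hev, c1, c2, c3, c4, c5, c6, c7⟩ :=
    L.exists_slots hn hk ha hC ht φ
  have hgood : Good ([[Gate.rx (-γ) (L.pos a)], [.rz (-β) (L.pos a)]] ++ S ++
      [[.rz β (L.pos a)], [.rx γ (L.pos a)]]) :=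
    ((Good.single_cons (g := .rx (-γ) (L.pos a)) trivial
      (Good.single_cons (g := .rz (-β) (L.pos a)) trivial good_nil)).append hS).append
      (Good.single_cons (g := .rz β (L.pos a)) trivial
        (Good.single_cons (g := .rx γ (L.pos a)) trivial good_nil))
  refine ⟨⟨_, fun l hl => (hgood l hl).1⟩, fun l hl => (hgood l hl).2, ?_, ?_, ?_, ?_, ?_, ?_, ?_,
    ?_⟩
  · have hz : matRz β * matRz (-β) = 1 := by rw [matRz_mul, add_neg_cancel, matRz_zero]
    have hx : matRx γ * matRx (-γ) = 1 := by rw [matRx_mul, add_neg_cancel, matRx_zero]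
    have hV : matRx γ * matRz β * (matRz (-β) * matRx (-γ)) = 1 := by
      rw [mul_assoc, ← mul_assoc (matRz β), hz, one_mul, hx]
    rw [← controlled_conj ht hV]
    have hs : ∀ A B : Matrix (Fin 2) (Fin 2) ℂ,
        single (L.pos a) (A * B) = single (L.pos a) A * single (L.pos a) B :=
      fun A B => (controlled_mul (Finset.notMem_empty _) A B).symm
    rw [hs, hs, ← hev]
    change ev _ = _
    simp only [List.flatten_append, ev_append, List.flatten_cons, List.flatten_nil, ev_singleton,
      ev_nil, one_mul, Gate.toOp, mul_assoc]
  · change cst _ _ = 8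
    simp [c1, Gate.isRotation]
  · change cst _ _ ≤ _
    simpa [Gate.isCNOT] using c2
  · change dpt _ _ ≤ _
    simpa [Gate.isCNOT] using c3
  · change cst _ _ ≤ _
    simpa [Gate.isT] using c4
  · change dpt _ _ ≤ _
    simpa [Gate.isT] using c5
  · change cst _ _ ≤ _
    simpa [Gate.isH] using c6
  · change dpt _ _ ≤ _
    simpa [Gate.isH] using c7
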